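/- **Theorem 2.** Let $\mathcal G=(\mathcal V,\mathcal E)$ be a connected undirected graph with $n$ nodes, $m$ edges and incidence matrix $B\in\mathbb R^{n\times m}$ (ends of edges arbitrarily signed), let $\mathcal G_c=(\mathcal V,\mathcal E_c)$ be a (not necessarily connected) graph with incidence matrix $B_c$, let $\mathcal V_e\subseteq\mathcal V$ with $|\mathcal V_e|=p\ge 1$ be the nodes with a controllable input, $\mathcal V_c\subseteq\mathcal V$ the nodes with a state dependent in/outflow, and let $E\in\mathbb R^{n\times p}$, $E_c\in\mathbb R^{n\times|\mathcal V_c|}$ be the corresponding $0$-$1$ location matrices. Consider $$T_x\dot x=\Psi(x)-B\lambda+Eu-d,\qquad y=h(x),\qquad \Psi(x)=-B_c\gamma(B_c^Th(x))-E_c\eta(E_c^Th(x)),$$ with $d\in\mathbb R^n$ constant and $h,\gamma,\eta$ acting componentwise through continuously differentiable functions $\mathbb R\to\mathbb R$, the $h_i$ strictly increasing, the $\gamma_k,\eta_i$ nondecreasing, in closed loop with $$T_\mu\dot\mu=B^T(h(x)-\overline y)-(f(\mu)-\xi),\quad T_\xi\dot\xi=f(\mu)-\xi,\quad \lambda=f(\mu),$$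 $$T_\theta\dot\theta=-E^T(h(x)-\overline y)-(g(\theta)-\phi),\quad T_\phi\dot\phi=g(\theta)-\phi-QL^{com}(Q\phi+r),\quad u=g(\theta).$$ Here $T_x,T_\mu,T_\xi,T_\theta,T_\phi$ are diagonal with positive entries, $C(u)=\frac12u^TQu+r^Tu+s$ is the cost of the input, with $Q=\mathrm{diag}(q_1,\dots,q_p)$, $q_i>0$, and $L^{com}$ is the Laplacian of a (nonnegatively weighted) directed graph on $\mathcal V_e$ that is balanced and strongly connected. Assume that $\overline y=h(\overline x)$ for some (necessarily unique) $\overline x\in\mathbb R^n$, and that $f,g$ act componentwise through continuously differentiable, strictly increasing functions with ranges $\mathcal R(f_k)=(\lambda_k^-,\lambda_k^+)$, $\mathcal R(g_i)=(u_i^-,u_i^+)$, where infinite bounds are allowed. Put $$\hat u=Q^{-1}(\hat\kappa-r),\qquad \hat\kappa=E^T\frac{\mathbf 1_n\mathbf 1_n^T}{\mathbf 1_p^TQ^{-1}\mathbf 1_p}(\hat d+EQ^{-1}r),\qquad \hat d=d+E_c\eta(E_c^Th(\overline x)),$$ and assume that $\hat u_i\in\mathcal R(g_i)$ for all $i$ and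 that for some $\omega\in\mathbb R^m$ all components $[B^\dagger(\Psi(\overline x)+E\hat u-d)+(I-B^\dagger B)\omega]_k$ lie in $\mathcal R(f_k)$, where $B^\dagger$ is the Moore-Penrose pseudoinverse. Then: 1. $\hat u$ is the unique optimal input of the problem of minimizing $C(u)$ over $(u,\lambda)$ subject to $\mathbf 0=\Psi(\overline x)-B\lambda+Eu-d$. 2. The closed loop has an equilibrium, and from every initial state it has a solution for all $t\ge0$. 3. Let $(\overline x,\overline\mu,\overline\xi,\overline\theta,\overline\phi)$ be any equilibrium and $$\Upsilon_2=\{(x,\mu,\xi,\theta,\phi): B(f(\mu)-f(\overline\mu))=\mathbf 0,\ B(\xi-\overline\xi)=\mathbf 0,\ x=\overline x,\ \theta=\overline\theta,\ \phi=\overline\phi\}.$$ On $\Upsilon_2$ one has $h(x)=\overline y$ and $g(\theta)=\hat u$. Every solution defined for all $t\ge 0$ converges, as $t\to\infty$, to a point of $\Upsilon_2$ which is itself an equilibrium (so that the flow $\lambda=f(\mu)$ is constant there). In particular $\|h(x(t))-\overline y\|\to0$ and $\|u(t)-\hat u\|\to0$. Moreover $u_i^-<u_i(t)<u_i^+$ and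 $\lambda_k^-<\lambda_k(t)<\lambda_k^+$ for all $i\in\mathcal V_e$, $k\in\mathcal E$ and $t\ge0$. -/

import Mathlib

open Filter Topology
open scoped Matrix

/-! ### Moore-Penrose pseudoinverse of a real matrix -/

/-- The four Penrose equations, which characterise the Moore-Penrose pseudoinverse of `A`. -/
structure IsMoorePenroseInverse {m n : Type*} [Fintype m] [Fintype n]
    (A : Matrix m n ℝ) (X : Matrix n m ℝ) : Prop where
  mul_mul_self : A * X * A = A
  self_mul_mul : X * A * X = X
  left_symm : (A * X)ᵀ = A * X
  right_symm : (X * A)ᵀ = X * A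

theorem exists_isMoorePenroseInverse {m n : Type*} [Fintype m] [Fintype n]
    (A : Matrix m n ℝ) : ∃ X, IsMoorePenroseInverse A X := by
  classical
  have hH : (Aᵀ * A).IsHermitian := by
    have := Matrix.isHermitian_conjTranspose_mul_self A
    rwa [Matrix.conjTranspose_eq_transpose_of_trivial] at this
  obtain ⟨G, hG1, hG2, hG3, hG4⟩ : ∃ G : Matrix n n ℝ, Gᵀ = G ∧
      (Aᵀ * A) * G * (Aᵀ * A) = Aᵀ * A ∧
      G * (Aᵀ * A) * G = G ∧ (Aᵀ * A) * G = G * (Aᵀ * A) := by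
    set e := hH.eigenvalues
    have hs := hH.spectral_theorem
    set U := Unitary.conjStarAlgAut ℝ (Matrix n n ℝ) hH.eigenvectorUnitary
    rw [hs]
    refine ⟨U (Matrix.diagonal (fun i => (e i)⁻¹)), ?_, ?_, ?_, ?_⟩
    · rw [← Matrix.conjTranspose_eq_transpose_of_trivial, ← Matrix.star_eq_conjTranspose,
        ← map_star, Matrix.star_eq_conjTranspose, Matrix.diagonal_conjTranspose]
      simp
    all_goals
      simp only [← map_mul, Matrix.diagonal_mul_diagonal]
      congr 2
      funext i
      by_cases h : e i = 0 <;> simp [e, h]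
  have hAGH : A * G * (Aᵀ * A) = A := by
    rw [← sub_eq_zero, ← Matrix.conjTranspose_mul_self_eq_zero,
      Matrix.conjTranspose_eq_transpose_of_trivial]
    have h1 : (A * G * (Aᵀ * A) - A)ᵀ = (Aᵀ * A) * G * Aᵀ - Aᵀ := by
      simp [Matrix.transpose_mul, hG1, Matrix.mul_assoc]
    have h2 : ((Aᵀ * A) * G * Aᵀ - Aᵀ) * (A * G * (Aᵀ * A) - A) =
        ((Aᵀ * A) * G * (Aᵀ * A)) * G * (Aᵀ * A) - (Aᵀ * A) * G * (Aᵀ * A)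
          - (Aᵀ * A) * G * (Aᵀ * A) + Aᵀ * A := by
      simp only [Matrix.sub_mul, Matrix.mul_sub, Matrix.mul_assoc]
      abel
    rw [h1, h2, hG2, hG2]
    abel
  refine ⟨G * Aᵀ, ⟨?_, ?_, ?_, ?_⟩⟩
  · simpa [Matrix.mul_assoc] using hAGH
  · calc G * Aᵀ * A * (G * Aᵀ) = G * (Aᵀ * A) * G * Aᵀ := by simp only [Matrix.mul_assoc]
      _ = G * Aᵀ := by rw [hG3]
  · simp [Matrix.transpose_mul, hG1, Matrix.mul_assoc]
  · have : (G * Aᵀ * A)ᵀ = (Aᵀ * A) * G := by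
      simp [Matrix.transpose_mul, hG1, Matrix.mul_assoc]
    rw [this, hG4, Matrix.mul_assoc]

/-- The Moore-Penrose pseudoinverse (the unique solution of the Penrose equations). -/
noncomputable def pinv {m n : Type*} [Fintype m] [Fintype n] (A : Matrix m n ℝ) :
    Matrix n m ℝ :=
  Classical.choose (exists_isMoorePenroseInverse A)

theorem pinv_spec {m n : Type*} [Fintype m] [Fintype n] (A : Matrix m n ℝ) :
    IsMoorePenroseInverse A (pinv A) :=
  Classical.choose_spec (exists_isMoorePenroseInverse A)

/-! ### Graphs, incidence matrices, indicator matrices, communication Laplacian -/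

/-- An undirected graph with node set `V` and edge set `K`, the two ends of every edge being
labelled (arbitrarily) with a plus and a minus sign. -/
structure OrientedGraph (V K : Type*) where
  pos : K → V
  neg : K → V
  pos_ne_neg : ∀ k, pos k ≠ neg k

/-- The underlying undirected graph. -/
def OrientedGraph.toSimpleGraph {V K : Type*} (G : OrientedGraph V K) : SimpleGraph V :=
  SimpleGraph.fromRel (fun i j => ∃ k, G.pos k = i ∧ G.neg k = j)

/-- The incidence matrix. -/
def OrientedGraph.incidence {V K : Type*} [DecidableEq V] (G : OrientedGraph V K) :
    Matrix V K ℝ :=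
  fun i k => if i = G.pos k then 1 else if i = G.neg k then -1 else 0

/-- The 0-1 matrix which places the `k`-th component, `k ∈ S`, at the node `k`. -/
def indicatorMatrix {V : Type*} [DecidableEq V] (S : Finset V) : Matrix V S ℝ :=
  fun i k => if i = (k : V) then 1 else 0

/-- A directed communication graph on `P` with nonnegative weights;
`weight i j > 0` means that there is an edge between `i` and `j` in the given direction. -/
structure CommGraph (P : Type*) where
  weight : P → P → ℝ
  weight_nonneg : ∀ i j, 0 ≤ weight i j

/-- Weighted in-degree equals weighted out-degree at every node. -/
def CommGraph.Balanced {P : Type*} [Fintype P] (G : CommGraph P) : Prop :=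
  ∀ i, ∑ j, G.weight i j = ∑ j, G.weight j i

/-- There is a directed path from every node to every node. -/
def CommGraph.StronglyConnected {P : Type*} (G : CommGraph P) : Prop :=
  ∀ i j, Relation.ReflTransGen (fun a b => 0 < G.weight a b) i j

/-- The Laplacian matrix (degree matrix minus adjacency matrix). -/
def CommGraph.laplacian {P : Type*} [Fintype P] [DecidableEq P] (G : CommGraph P) :
    Matrix P P ℝ :=
  Matrix.diagonal (fun i => ∑ j, G.weight i j) - Matrix.of G.weight

/-! ### The compartmental flow network -/

/-- Data of the network: nodes `V`, actuated edges `K`, compartmental edges `Kc`, nodes with a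
controllable input `actuated`, nodes with a state dependent in/outflow `compartments`. -/
structure FlowNetwork (V K Kc : Type*) where
  graph : OrientedGraph V K
  compGraph : OrientedGraph V Kc
  actuated : Finset V
  compartments : Finset V
  Tx : V → ℝ
  Tx_pos : ∀ i, 0 < Tx i
  /-- the constant disturbance -/
  d : V → ℝ
  /-- the output maps -/
  h : V → ℝ → ℝ
  h_contDiff : ∀ i, ContDiff ℝ 1 (h i)
  h_strictMono : ∀ i, StrictMono (h i)
  γ : Kc → ℝ → ℝ
  γ_contDiff : ∀ k, ContDiff ℝ 1 (γ k)
  γ_mono : ∀ k, Monotone (γ k)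
  η : compartments → ℝ → ℝ
  η_contDiff : ∀ i, ContDiff ℝ 1 (η i)
  η_mono : ∀ i, Monotone (η i)

namespace FlowNetwork

variable {V K Kc : Type*} [Fintype V] [DecidableEq V] [Fintype K] [Fintype Kc]

/-- Incidence matrix of the actuated graph. -/
def B (N : FlowNetwork V K Kc) : Matrix V K ℝ := N.graph.incidence

/-- Incidence matrix of the compartmental graph. -/
def Bc (N : FlowNetwork V K Kc) : Matrix V Kc ℝ := N.compGraph.incidence

/-- Location of the controllable inputs. -/
def E (N : FlowNetwork V K Kc) : Matrix V N.actuated ℝ := indicatorMatrix N.actuated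

/-- Location of the state dependent in/outflows. -/
def Ec (N : FlowNetwork V K Kc) : Matrix V N.compartments ℝ := indicatorMatrix N.compartments

/-- The output `y = h(x)`. -/
def output (N : FlowNetwork V K Kc) (x : V → ℝ) : V → ℝ := fun i => N.h i (x i)

/-- The state dependent in/outflows `η(E_cᵀ h(x))`. -/
def compFlow (N : FlowNetwork V K Kc) (x : V → ℝ) : N.compartments → ℝ :=
  fun i => N.η i ((N.Ecᵀ *ᵥ N.output x) i)

/-- `Ψ(x) = - B_c γ(B_cᵀ h(x)) - E_c η(E_cᵀ h(x))`. -/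
def Psi (N : FlowNetwork V K Kc) (x : V → ℝ) : V → ℝ :=
  -(N.Bc *ᵥ (fun k => N.γ k ((N.Bcᵀ *ᵥ N.output x) k))) - N.Ec *ᵥ N.compFlow x

end FlowNetwork

/-! ### The optimal input -/

/-- Strictly convex linear-quadratic costs `q u² / 2 + r u + s` of the inputs. -/
structure InputCost (P : Type*) where
  q : P → ℝ
  q_pos : ∀ i, 0 < q i
  r : P → ℝ
  s : P → ℝ

/-- The matrix `Q = diag(q)`. -/
def InputCost.Q {P : Type*} [DecidableEq P] (c : InputCost P) : Matrix P P ℝ :=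
  Matrix.diagonal c.q

/-- The total cost. -/
noncomputable def InputCost.total {P : Type*} [Fintype P] (c : InputCost P) (u : P → ℝ) : ℝ :=
  ∑ i, (1 / 2 * c.q i * u i ^ 2 + c.r i * u i + c.s i)

namespace FlowNetwork

variable {V K Kc : Type*} [Fintype V] [DecidableEq V] [Fintype K] [Fintype Kc]

/-- The disturbance, including the in/outflows at the state `xbar`. -/
def dHat (N : FlowNetwork V K Kc) (xbar : V → ℝ) : V → ℝ :=
  N.d + N.Ec *ᵥ N.compFlow xbar

/-- `κ̂ = Eᵀ (1 1ᵀ / (1ᵀ Q⁻¹ 1)) (d̂ + E Q⁻¹ r)`. -/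
noncomputable def kappaHat (N : FlowNetwork V K Kc) (c : InputCost N.actuated)
    (xbar : V → ℝ) : N.actuated → ℝ :=
  N.Eᵀ *ᵥ (((1 : N.actuated → ℝ) ⬝ᵥ (c.Q⁻¹ *ᵥ 1))⁻¹ • Matrix.vecMulVec (1 : V → ℝ) 1) *ᵥ
    (N.dHat xbar + N.E *ᵥ c.Q⁻¹ *ᵥ c.r)

/-- `û = Q⁻¹ (κ̂ - r)`. -/
noncomputable def uHat (N : FlowNetwork V K Kc) (c : InputCost N.actuated)
    (xbar : V → ℝ) : N.actuated → ℝ :=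
  c.Q⁻¹ *ᵥ (N.kappaHat c xbar - c.r)

/-- Input `u` and flow `lam` keep the network at rest in the state `xbar`. -/
def SteadyInput (N : FlowNetwork V K Kc) (xbar : V → ℝ) (u : N.actuated → ℝ)
    (lam : K → ℝ) : Prop :=
  0 = N.Psi xbar - N.B *ᵥ lam + N.E *ᵥ u - N.d

/-- `u` is the unique optimal input of the problem of minimising the total cost over all `(u, lam)`
with `0 = Ψ(xbar) - B lam + E u - d`. -/
def IsOptimalInput (N : FlowNetwork V K Kc) (c : InputCost N.actuated) (xbar : V → ℝ)
    (u : N.actuated → ℝ) : Prop :=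
  (∃ lam, N.SteadyInput xbar u lam) ∧
    ∀ u' lam', N.SteadyInput xbar u' lam' → u' ≠ u → c.total u < c.total u'

end FlowNetwork

/-! ### Controllers and closed loop -/

/-- Data of the flow controller (on the edges `K`) and of the input controller
(at the actuated nodes `P`); `comm` is the communication graph of the input controllers. -/
structure Controller (K P : Type*) where
  Tμ : K → ℝ
  Tμ_pos : ∀ k, 0 < Tμ k
  Tξ : K → ℝ
  Tξ_pos : ∀ k, 0 < Tξ k
  Tθ : P → ℝ
  Tθ_pos : ∀ i, 0 < Tθ i
  Tφ : P → ℝ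
  Tφ_pos : ∀ i, 0 < Tφ i
  f : K → ℝ → ℝ
  g : P → ℝ → ℝ
  comm : CommGraph P

/-- The flow `λ = f(μ)`. -/
def Controller.flow {K P : Type*} (C : Controller K P) (μ : K → ℝ) : K → ℝ :=
  fun k => C.f k (μ k)

/-- The input `u = g(θ)`. -/
def Controller.input {K P : Type*} (C : Controller K P) (θ : P → ℝ) : P → ℝ :=
  fun i => C.g i (θ i)

/-- The controller functions are continuously differentiable and strictly increasing, and their
ranges are the open intervals of admissible values; infinite bounds are allowed. -/
structure Controller.OutputsWithin {K P : Type*} (C : Controller K P)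
    (lamLo lamHi : K → EReal) (uLo uHi : P → EReal) : Prop where
  f_contDiff : ∀ k, ContDiff ℝ 1 (C.f k)
  f_strictMono : ∀ k, StrictMono (C.f k)
  f_range : ∀ k, Set.range (C.f k) = {z : ℝ | lamLo k < (z : EReal) ∧ (z : EReal) < lamHi k}
  g_contDiff : ∀ i, ContDiff ℝ 1 (C.g i)
  g_strictMono : ∀ i, StrictMono (C.g i)
  g_range : ∀ i, Set.range (C.g i) = {z : ℝ | uLo i < (z : EReal) ∧ (z : EReal) < uHi i}

/-- States of the closed loop. -/
@[ext]
structure State (V K P : Type*) where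
  x : V → ℝ
  μ : K → ℝ
  ξ : K → ℝ
  θ : P → ℝ
  φ : P → ℝ

/-- Convergence of a trajectory to a point as `t → ∞`. -/
def ConvergesTo {V K P : Type*} (z : ℝ → State V K P) (a : State V K P) : Prop :=
  Tendsto (fun t => (z t).x) atTop (𝓝 a.x) ∧ Tendsto (fun t => (z t).μ) atTop (𝓝 a.μ) ∧
  Tendsto (fun t => (z t).ξ) atTop (𝓝 a.ξ) ∧ Tendsto (fun t => (z t).θ) atTop (𝓝 a.θ) ∧
  Tendsto (fun t => (z t).φ) atTop (𝓝 a.φ)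

namespace FlowNetwork

variable {V K Kc : Type*} [Fintype V] [DecidableEq V] [Fintype K] [DecidableEq K] [Fintype Kc]

/-- Right-hand sides of the closed-loop equations (for `T_x ẋ`, `T_μ μ̇`, `T_ξ ξ̇`, `T_θ θ̇`,
`T_φ φ̇`). -/
def rhs (N : FlowNetwork V K Kc) (c : InputCost N.actuated) (C : Controller K N.actuated)
    (ybar : V → ℝ) (z : State V K N.actuated) : State V K N.actuated where
  x := N.Psi z.x - N.B *ᵥ C.flow z.μ + N.E *ᵥ C.input z.θ - N.d
  μ := N.Bᵀ *ᵥ (N.output z.x - ybar) - (C.flow z.μ - z.ξ)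
  ξ := C.flow z.μ - z.ξ
  θ := -(N.Eᵀ *ᵥ (N.output z.x - ybar)) - (C.input z.θ - z.φ)
  φ := C.input z.θ - z.φ - c.Q *ᵥ C.comm.laplacian *ᵥ (c.Q *ᵥ z.φ + c.r)

/-- `z` is a solution, for `t ≥ 0`, of the closed loop (with one-sided derivative at `t = 0`). -/
def IsSolution (N : FlowNetwork V K Kc) (c : InputCost N.actuated) (C : Controller K N.actuated)
    (ybar : V → ℝ) (z : ℝ → State V K N.actuated) : Prop :=
  ∀ t : ℝ, 0 ≤ t → ∃ z' : State V K N.actuated,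
    HasDerivWithinAt (fun s => (z s).x) z'.x (Set.Ici 0) t ∧
    HasDerivWithinAt (fun s => (z s).μ) z'.μ (Set.Ici 0) t ∧
    HasDerivWithinAt (fun s => (z s).ξ) z'.ξ (Set.Ici 0) t ∧
    HasDerivWithinAt (fun s => (z s).θ) z'.θ (Set.Ici 0) t ∧
    HasDerivWithinAt (fun s => (z s).φ) z'.φ (Set.Ici 0) t ∧
    Matrix.diagonal N.Tx *ᵥ z'.x = (N.rhs c C ybar (z t)).x ∧
    Matrix.diagonal C.Tμ *ᵥ z'.μ = (N.rhs c C ybar (z t)).μ ∧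
    Matrix.diagonal C.Tξ *ᵥ z'.ξ = (N.rhs c C ybar (z t)).ξ ∧
    Matrix.diagonal C.Tθ *ᵥ z'.θ = (N.rhs c C ybar (z t)).θ ∧
    Matrix.diagonal C.Tφ *ᵥ z'.φ = (N.rhs c C ybar (z t)).φ

/-- Equilibria (steady states) of the closed loop. -/
def IsEquilibrium (N : FlowNetwork V K Kc) (c : InputCost N.actuated)
    (C : Controller K N.actuated) (ybar : V → ℝ) (e : State V K N.actuated) : Prop :=
  N.rhs c C ybar e = ⟨0, 0, 0, 0, 0⟩

/-- The set `Υ₂` belonging to a steady state `e = (xbar, μbar, ξbar, θbar, φbar)`. -/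
def Upsilon2 (N : FlowNetwork V K Kc) (C : Controller K N.actuated)
    (e : State V K N.actuated) : Set (State V K N.actuated) :=
  {z | N.B *ᵥ (C.flow z.μ - C.flow e.μ) = 0 ∧ N.B *ᵥ (z.ξ - e.ξ) = 0 ∧
    z.x = e.x ∧ z.θ = e.θ ∧ z.φ = e.φ}

/-- Attainability of the steady state: some solution
`B† (Ψ(xbar) + E û - d) + (I - B† B) ω` of the steady state equation for the flow, and the
optimal input `û`, are in the ranges of the controller functions. -/
def Attainable (N : FlowNetwork V K Kc) (c : InputCost N.actuated)
    (C : Controller K N.actuated) (xbar : V → ℝ) : Prop :=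
  (∃ ω : K → ℝ, ∀ k,
    (pinv N.B *ᵥ (N.Psi xbar + N.E *ᵥ N.uHat c xbar - N.d) +
      (1 - pinv N.B * N.B) *ᵥ ω : K → ℝ) k ∈ Set.range (C.f k)) ∧
  ∀ i, N.uHat c xbar i ∈ Set.range (C.g i)

end FlowNetwork

/-! ### Global solutions of autonomous differential equations -/

section Autonomous

variable {E : Type*} [NormedAddCommGroup E] [NormedSpace ℝ E]

/-! The closed loop is an interconnection of incrementally passive systems. For an equilibrium `e`,
the storage function sums, over all states, the time constant times the primitive of `k - k e`,
where `k` is `h`, `f`, the identity, `g` and the identity for `x`, `μ`, `ξ`, `θ`, `φ`. Along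
trajectories the coupling terms through `B` and `E` cancel, leaving the monotonicity term of `Ψ`,
the negative squares of `f(μ) - ξ` and `g(θ) - φ`, and minus the Laplacian form at `Q(φ - φbar)`.
The last is nonnegative before the sign because the communication graph is balanced
(`sum_storageMaps_mul_vectorField`).

Primitives of increments of strictly increasing functions grow at least linearly, so the storage
function is coercive even when `f` and `g` are bounded. This excludes blow-up and makes LaSalle's
principle applicable. Without dissipation, `ξ` and `φ` are at rest, hence so are `μ` and `θ` by
injectivity of `f` and `g`. Their equations then force the output error into the kernels of `Bᵀ` and
`Eᵀ`, so it vanishes: the graph is connected and some node is actuated. Thus `x` rests too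
(`vectorField_eq_zero_of_not_dissipating`).

Equilibria need not be unique, since flows may differ by an element of `ker B`. Convergence to a
single point holds because every equilibrium has its own storage function: that of a cluster point
decreases to zero along the trajectory (`exists_tendsto_equilibrium`).

For optimality, connectedness turns the steady state constraint into a prescribed total input, and
`uHat` is the input with this total and equal marginal costs. All equilibria carry this input
(`IsEquilibrium.eq_and_steadyInput`). -/

theorem IsIntegralCurveOn.hasDerivWithinAt_Ici {F : E → E} {w : ℝ → E} {s : Set ℝ} {t : ℝ}
    (hw : IsIntegralCurveOn w (fun _ => F) s) (ht : t ∈ s) (hs : s ∈ 𝓝[≥] t) :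
    HasDerivWithinAt w (F (w t)) (Set.Ici t) t :=
  (hw t ht).mono_of_mem_nhdsWithin hs

theorem IsIntegralCurveOn.dist_le_of_lipschitzWith {F : E → E} {K : NNReal}
    (hF : LipschitzWith K F) {w₁ w₂ : ℝ → E} {T : ℝ}
    (h₁ : IsIntegralCurveOn w₁ (fun _ => F) (Set.Icc 0 T))
    (h₂ : IsIntegralCurveOn w₂ (fun _ => F) (Set.Icc 0 T)) {t : ℝ} (ht : t ∈ Set.Icc 0 T) :
    dist (w₁ t) (w₂ t) ≤ dist (w₁ 0) (w₂ 0) * Real.exp (K * t) := by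
  have hmem : ∀ t ∈ Set.Ico 0 T, Set.Icc 0 T ∈ 𝓝[≥] t := fun t ht =>
    Filter.mem_of_superset (Icc_mem_nhdsGE ht.2) (Set.Icc_subset_Icc_left ht.1)
  simpa using dist_le_of_trajectories_ODE (v := fun _ => F) (fun _ => hF) h₁.continuousOn
    (fun t ht => h₁.hasDerivWithinAt_Ici (Set.Ico_subset_Icc_self ht) (hmem t ht))
    h₂.continuousOn
    (fun t ht => h₂.hasDerivWithinAt_Ici (Set.Ico_subset_Icc_self ht) (hmem t ht)) le_rfl t ht

open scoped Pointwise in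
theorem IsIntegralCurveOn.comp_add_nonneg {F : E → E} {w : ℝ → E}
    (hw : IsIntegralCurveOn w (fun _ => F) (Set.Ici 0)) {τ : ℝ} (hτ : 0 ≤ τ) :
    IsIntegralCurveOn (fun t => w (t + τ)) (fun _ => F) (Set.Ici 0) := by
  have h := hw.comp_add τ
  refine IsIntegralCurveOn.mono (s := -τ +ᵥ Set.Ici (0 : ℝ)) h fun t (ht : 0 ≤ t) => ?_
  rw [Set.mem_vadd_set_iff_neg_vadd_mem]
  simp only [neg_neg, vadd_eq_add, Set.mem_Ici]
  linarith

/-- A curve of speed at most `L` stays within distance `L * n` of its start up to time `n`, so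
Picard-Lindelöf applies on each `[0, n]`. Grönwall's inequality makes these solutions agree, and
they are glued. -/
theorem exists_isIntegralCurveOn_Ici_of_lipschitzWith [CompleteSpace E] {F : E → E} {K L : NNReal}
    (hF : LipschitzWith K F) (hb : ∀ x, ‖F x‖ ≤ L) (x₀ : E) :
    ∃ w : ℝ → E, w 0 = x₀ ∧ IsIntegralCurveOn w (fun _ => F) (Set.Ici 0) := by
  have hloc : ∀ n : ℕ, ∃ w : ℝ → E, w 0 = x₀ ∧
      IsIntegralCurveOn w (fun _ => F) (Set.Icc 0 (n : ℝ)) := by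
    intro n
    have hp : IsPicardLindelof (fun _ => F) (tmin := 0) (tmax := n)
        ⟨0, Set.left_mem_Icc.2 n.cast_nonneg⟩ x₀ (L * n) 0 L K :=
      .of_time_independent (fun x _ => hb x) hF.lipschitzOnWith (by simp)
    exact hp.exists_eq_forall_mem_Icc_hasDerivWithinAt₀
  choose w hw0 hw using hloc
  have hagree : ∀ {m n : ℕ} {t : ℝ}, t ∈ Set.Icc (0 : ℝ) m → t ∈ Set.Icc (0 : ℝ) n →
      w m t = w n t := by
    intro m n t hm hn
    have h := IsIntegralCurveOn.dist_le_of_lipschitzWith hF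
      ((hw m).mono (Set.Icc_subset_Icc_right (min_le_left (m : ℝ) n)))
      ((hw n).mono (Set.Icc_subset_Icc_right (min_le_right (m : ℝ) n)))
      (t := t) ⟨hm.1, le_min hm.2 hn.2⟩
    rw [hw0, hw0, dist_self, zero_mul] at h
    exact dist_le_zero.1 h
  have hmem : ∀ t : ℝ, 0 ≤ t → t ∈ Set.Icc (0 : ℝ) (⌈t⌉₊ : ℝ) := fun t ht => ⟨ht, Nat.le_ceil t⟩
  refine ⟨fun t => w ⌈t⌉₊ t, hw0 _, fun t (ht : 0 ≤ t) => ?_⟩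
  -- The index is `⌈t⌉₊ + 1` because `⌈t⌉₊` may equal `t`, whereas the derivative needs one solution
  -- on both sides of `t`.
  have ht' : t < ((⌈t⌉₊ + 1 : ℕ) : ℝ) := by push_cast; linarith [Nat.le_ceil t]
  have heq : ∀ s ∈ Set.Icc (0 : ℝ) ((⌈t⌉₊ + 1 : ℕ) : ℝ), w ⌈s⌉₊ s = w (⌈t⌉₊ + 1) s :=
    fun s hs => hagree (hmem s hs.1) hs
  have hd := (hw (⌈t⌉₊ + 1) t ⟨ht, ht'.le⟩).congr heq (heq t ⟨ht, ht'.le⟩)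
  rw [← heq t ⟨ht, ht'.le⟩] at hd
  refine hd.mono_of_mem_nhdsWithin ?_
  rw [← Set.Ici_inter_Iic]
  exact Filter.inter_mem self_mem_nhdsWithin (mem_nhdsWithin_of_mem_nhds (Iic_mem_nhds ht'))

/-- A `C¹` vector field is, on any ball, equal to a bounded globally Lipschitz field obtained by
multiplication with a nonnegative function. -/
theorem ContDiff.exists_lipschitzWith_cutoff [FiniteDimensional ℝ E] {F : E → E}
    (hF : ContDiff ℝ 1 F) (R : ℝ) :
    ∃ (ρ : E → ℝ) (K L : NNReal), (∀ x, 0 ≤ ρ x) ∧ (∀ x, ‖x‖ ≤ R → ρ x = 1) ∧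
      LipschitzWith K (fun x => ρ x • F x) ∧ ∀ x, ‖ρ x • F x‖ ≤ L := by
  -- The inner radius of a bump function must be positive, while `R` is arbitrary.
  have hR : 0 < max R 1 := lt_max_of_lt_right one_pos
  let b : ContDiffBump (0 : E) := ⟨max R 1, max R 1 + 1, hR, by linarith⟩
  have hsupp : HasCompactSupport (fun x => b x • F x) := b.hasCompactSupport.smul_right
  have hcd : ContDiff ℝ 1 (fun x => b x • F x) := b.contDiff.smul hF
  obtain ⟨K, hK⟩ := hcd.lipschitzWith_of_hasCompactSupport hsupp one_ne_zero
  obtain ⟨L, hL⟩ := hsupp.exists_bound_of_continuous hcd.continuous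
  refine ⟨b, K, ⟨max L 0, le_max_right _ _⟩, fun x => b.nonneg, fun x hx => ?_, hK,
    fun x => (hL x).trans (le_max_left _ _)⟩
  exact b.one_of_mem_closedBall (by simpa [b] using Or.inl hx)

/-! ### Lyapunov functions -/

/-- `W` is a differentiable function with compact sublevel sets which does not increase along the
vector field `F`. -/
structure IsLyapunovFunction (F : E → E) (W : E → ℝ) (W' : E → E →L[ℝ] ℝ) : Prop where
  hasFDerivAt : ∀ x, HasFDerivAt W (W' x) x
  nonpos : ∀ x, W' x (F x) ≤ 0
  coercive : Tendsto W (cocompact E) atTop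

namespace IsLyapunovFunction

variable {F : E → E} {W : E → ℝ} {W' : E → E →L[ℝ] ℝ}

theorem continuous (hW : IsLyapunovFunction F W W') : Continuous W :=
  continuous_iff_continuousAt.2 fun x => (hW.hasFDerivAt x).continuousAt

theorem hasDerivWithinAt (hW : IsLyapunovFunction F W W') {w : ℝ → E} {s : Set ℝ} {t : ℝ}
    (hw : IsIntegralCurveOn w (fun _ => F) s) (ht : t ∈ s) :
    HasDerivWithinAt (fun t => W (w t)) (W' (w t) (F (w t))) s t :=
  (hW.hasFDerivAt (w t)).comp_hasDerivWithinAt t (hw t ht)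

theorem antitoneOn (hW : IsLyapunovFunction F W W') {w : ℝ → E}
    (hw : IsIntegralCurveOn w (fun _ => F) (Set.Ici 0)) :
    AntitoneOn (fun t => W (w t)) (Set.Ici 0) :=
  antitoneOn_of_hasDerivWithinAt_nonpos (convex_Ici 0)
    (fun _ ht => (hW.hasDerivWithinAt hw ht).continuousWithinAt)
    (fun _ ht => (hW.hasDerivWithinAt hw (interior_subset ht)).mono interior_subset)
    (fun _ _ => hW.nonpos _)

theorem smul (hW : IsLyapunovFunction F W W') {ρ : E → ℝ} (hρ : ∀ x, 0 ≤ ρ x) :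
    IsLyapunovFunction (fun x => ρ x • F x) W W' where
  hasFDerivAt := hW.hasFDerivAt
  nonpos x := by
    rw [map_smul]
    exact mul_nonpos_of_nonneg_of_nonpos (hρ x) (hW.nonpos x)
  coercive := hW.coercive

theorem exists_norm_le (hW : IsLyapunovFunction F W W') (M : ℝ) :
    ∃ R, ∀ x, W x ≤ M → ‖x‖ ≤ R := by
  have h := hW.coercive.eventually_gt_atTop M
  obtain ⟨K, hK, hKM⟩ := Filter.mem_cocompact.1 h
  obtain ⟨R, hR⟩ := hK.isBounded.exists_norm_le
  refine ⟨R, fun x hx => hR x ?_⟩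
  by_contra hxK
  exact absurd hx (not_le.2 (hKM hxK))

theorem isBounded_trajectory (hW : IsLyapunovFunction F W W') (M : ℝ) :
    ∃ R, ∀ w, IsIntegralCurveOn w (fun _ => F) (Set.Ici 0) → W (w 0) ≤ M →
      ∀ t, 0 ≤ t → ‖w t‖ ≤ R := by
  obtain ⟨R, hR⟩ := hW.exists_norm_le M
  exact ⟨R, fun w hw h0 t ht => hR _ ((hW.antitoneOn hw Set.self_mem_Ici ht ht).trans h0)⟩

variable [FiniteDimensional ℝ E]

/-- A Lyapunov function with compact sublevel sets prevents blow-up in finite time. -/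
theorem exists_isIntegralCurveOn_Ici (hW : IsLyapunovFunction F W W') (hF : ContDiff ℝ 1 F)
    (x₀ : E) : ∃ w : ℝ → E, w 0 = x₀ ∧ IsIntegralCurveOn w (fun _ => F) (Set.Ici 0) := by
  obtain ⟨R, hR⟩ := hW.exists_norm_le (W x₀)
  obtain ⟨ρ, K, L, hρ, hρ1, hK, hL⟩ := hF.exists_lipschitzWith_cutoff R
  have := FiniteDimensional.complete ℝ E
  obtain ⟨w, hw0, hw⟩ := exists_isIntegralCurveOn_Ici_of_lipschitzWith hK hL x₀
  refine ⟨w, hw0, fun t ht => ?_⟩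
  have h := hw t ht
  -- The cut-off field is a nonnegative multiple of `F`, so `W` still does not increase. The curve
  -- therefore never leaves the region where `ρ = 1` and solves the original equation.
  have hle := (hW.smul hρ).antitoneOn hw Set.self_mem_Ici ht ht
  simp only [hw0] at hle
  simpa only [hρ1 _ (hR _ hle), one_smul] using h

theorem exists_tendsto_comp (hW : IsLyapunovFunction F W W') {w : ℝ → E}
    (hw : IsIntegralCurveOn w (fun _ => F) (Set.Ici 0)) :
    ∃ ℓ, Tendsto (fun t => W (w t)) atTop (𝓝 ℓ) := by
  obtain ⟨R, hR⟩ := hW.isBounded_trajectory (W (w 0))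
  have := FiniteDimensional.proper ℝ E
  obtain ⟨m, hm⟩ := ((isCompact_closedBall (0 : E) R).image hW.continuous).bddBelow
  -- Freezing time at `0` for negative arguments turns monotonicity on `[0, ∞)` into monotonicity on
  -- the line.
  have hanti : Antitone fun t => W (w (max t 0)) := fun s t hst =>
    hW.antitoneOn hw (le_max_right s 0) (le_max_right t 0) (max_le_max_right 0 hst)
  have hbdd : BddBelow (Set.range fun t => W (w (max t 0))) := by
    refine ⟨m, ?_⟩
    rintro _ ⟨t, rfl⟩
    exact hm ⟨_, by simpa using hR w hw le_rfl _ (le_max_right t 0), rfl⟩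
  refine ⟨_, (tendsto_atTop_ciInf hanti hbdd).congr' ?_⟩
  filter_upwards [eventually_ge_atTop 0] with t ht
  rw [max_eq_left ht]

/-- **LaSalle's invariance principle**: through every cluster point of a trajectory passes a
trajectory along which the Lyapunov function is constant. -/
theorem exists_trajectory_of_mapClusterPt (hW : IsLyapunovFunction F W W') (hF : ContDiff ℝ 1 F)
    {w : ℝ → E} (hw : IsIntegralCurveOn w (fun _ => F) (Set.Ici 0)) {a : E}
    (ha : MapClusterPt a atTop w) :
    ∃ v : ℝ → E, v 0 = a ∧ IsIntegralCurveOn v (fun _ => F) (Set.Ici 0) ∧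
      ∀ t, 0 ≤ t → W' (v t) (F (v t)) = 0 := by
  obtain ⟨v, hv0, hv⟩ := hW.exists_isIntegralCurveOn_Ici hF a
  obtain ⟨ℓ, hℓ⟩ := hW.exists_tendsto_comp hw
  obtain ⟨R, hR⟩ := hW.isBounded_trajectory (max (W (w 0)) (W a))
  obtain ⟨ρ, K, L, hρ, hρ1, hK, hL⟩ := hF.exists_lipschitzWith_cutoff R
  -- Trajectories starting below this common level also solve the globally Lipschitz cut-off
  -- equation, to which Grönwall's inequality applies.
  have hcut : ∀ u, IsIntegralCurveOn u (fun _ => F) (Set.Ici 0) →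
      W (u 0) ≤ max (W (w 0)) (W a) →
      IsIntegralCurveOn u (fun _ x => ρ x • F x) (Set.Ici 0) := by
    intro u hu hu0 t ht
    simpa only [hρ1 _ (hR u hu hu0 t ht), one_smul] using hu t ht
  have hconst : ∀ s, 0 ≤ s → W (v s) = ℓ := by
    intro s hs
    obtain ⟨u, hua, hu⟩ := ha.exists_seq_tendsto
    -- Continuous dependence on initial data: the shifted trajectories start at `w (u n)`, which
    -- tends to `a = v 0`.
    have hconv : Tendsto (fun n => w (s + u n)) atTop (𝓝 (v s)) := by
      rw [tendsto_iff_dist_tendsto_zero]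
      have hlim : Tendsto (fun n => dist (w (u n)) a * Real.exp (K * s)) atTop (𝓝 0) := by
        simpa using (tendsto_iff_dist_tendsto_zero.1 hua).mul_const (Real.exp (K * s))
      refine squeeze_zero' (.of_forall fun _ => dist_nonneg) ?_ hlim
      filter_upwards [hu.eventually_ge_atTop 0] with n hn
      have hsh := hw.comp_add_nonneg hn
      have h1 := hcut _ hsh (by
        simpa using Or.inl (hW.antitoneOn hw Set.self_mem_Ici hn hn))
      have h2 := hcut v hv (by simp [hv0])
      have := IsIntegralCurveOn.dist_le_of_lipschitzWith hK
        (h1.mono Set.Icc_subset_Ici_self) (h2.mono Set.Icc_subset_Ici_self)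
        (Set.right_mem_Icc.2 hs)
      simpa [hv0] using this
    exact tendsto_nhds_unique ((hW.continuous.tendsto _).comp hconv)
      (hℓ.comp (tendsto_atTop_add_const_left _ s hu))
  refine ⟨v, hv0, hv, fun t ht => ?_⟩
  have h1 := hW.hasDerivWithinAt hv ht
  have h2 : HasDerivWithinAt (fun t => W (v t)) 0 (Set.Ici 0) t :=
    (hasDerivWithinAt_const t _ ℓ).congr (fun s hs => hconst s hs) (hconst t ht)
  exact (uniqueDiffOn_Ici (0 : ℝ) t ht).eq_deriv _ h1 h2

/-- If every equilibrium `e` has a Lyapunov function `W e` with unique minimizer `e`, and the only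
trajectories along which these are constant start in equilibria, then every trajectory converges
to an equilibrium. -/
theorem exists_tendsto_equilibrium {F : E → E} {W : E → E → ℝ} {W' : E → E → E →L[ℝ] ℝ}
    (hF : ContDiff ℝ 1 F) (hW : ∀ e, F e = 0 → IsLyapunovFunction F (W e) (W' e))
    (hself : ∀ e, W e e = 0) (hne : ∀ e z, W e z = 0 → z = e)
    (hinv : ∀ e, F e = 0 → ∀ v : ℝ → E, IsIntegralCurveOn v (fun _ => F) (Set.Ici 0) →
      (∀ t, 0 ≤ t → W' e (v t) (F (v t)) = 0) → F (v 0) = 0)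
    (hex : ∃ e, F e = 0) {w : ℝ → E} (hw : IsIntegralCurveOn w (fun _ => F) (Set.Ici 0)) :
    ∃ a, F a = 0 ∧ Tendsto w atTop (𝓝 a) := by
  obtain ⟨e, he⟩ := hex
  have := FiniteDimensional.proper ℝ E
  obtain ⟨R, hR⟩ := (hW e he).isBounded_trajectory (W e (w 0))
  have hball : ∀ᶠ t in atTop, w t ∈ Metric.closedBall (0 : E) R := by
    filter_upwards [eventually_ge_atTop 0] with t ht
    simpa using hR w hw le_rfl t ht
  obtain ⟨a, -, ha⟩ := (isCompact_closedBall (0 : E) R).exists_mapClusterPt_of_frequently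
    hball.frequently
  have hFa : F a = 0 := by
    obtain ⟨v, hv0, hv, hv'⟩ := (hW e he).exists_trajectory_of_mapClusterPt hF hw ha
    exact hv0 ▸ hinv e he v hv hv'
  refine ⟨a, hFa, (isCompact_closedBall (0 : E) R).tendsto_nhds_of_unique_mapClusterPt hball
    fun b _ hb => hne a b ?_⟩
  -- The storage function is now that of the cluster point `a` itself. Its limit along `w` is its
  -- value at every cluster point, and this value is zero at `a`.
  obtain ⟨ℓ, hℓ⟩ := (hW a hFa).exists_tendsto_comp hw
  have hlim : ∀ b, MapClusterPt b atTop w → W a b = ℓ := by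
    intro b hb
    obtain ⟨u, hub, hu⟩ := hb.exists_seq_tendsto
    exact tendsto_nhds_unique (((hW a hFa).continuous.tendsto b).comp hub) (hℓ.comp hu)
  rw [hlim b hb, ← hlim a ha, hself]

end IsLyapunovFunction

end Autonomous

/-! ### Separable potentials -/

/-- The primitive of `k - k a` which vanishes at `a` (the Bregman divergence of a primitive
of `k`). -/
noncomputable def potential (k : ℝ → ℝ) (a s : ℝ) : ℝ := ∫ σ in a..s, (k σ - k a)

section Potential

variable {k : ℝ → ℝ}

@[simp] theorem potential_self (k : ℝ → ℝ) (a : ℝ) : potential k a a = 0 := by simp [potential]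

theorem hasDerivAt_potential (hk : Continuous k) (a s : ℝ) :
    HasDerivAt (potential k a) (k s - k a) s :=
  ((hk.sub continuous_const).integral_hasStrictDerivAt a s).hasDerivAt

theorem potential_nonneg (hmono : Monotone k) (a s : ℝ) : 0 ≤ potential k a s := by
  rcases le_total a s with h | h
  · exact intervalIntegral.integral_nonneg h fun σ hσ => sub_nonneg.2 (hmono hσ.1)
  · rw [potential, intervalIntegral.integral_symm, ← intervalIntegral.integral_neg]
    exact intervalIntegral.integral_nonneg h fun σ hσ => by
      have := hmono hσ.2
      linarith

/-- The potential is convex and so lies above its tangent line at `m`; the nonnegative value at `m`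
is dropped. Taking `m` between `a` and `s` gives positivity, and `m = a ± 1` gives linear growth. -/
theorem le_potential (hk : Continuous k) (hmono : Monotone k) (a m s : ℝ) :
    (s - m) * (k m - k a) ≤ potential k a s := by
  have hi : ∀ b x y : ℝ, IntervalIntegrable (fun σ => k σ - k b) MeasureTheory.volume x y :=
    fun b x y => (hk.sub continuous_const).intervalIntegrable x y
  have h1 : potential k a s = potential k a m + ∫ σ in m..s, (k σ - k a) :=
    (intervalIntegral.integral_add_adjacent_intervals (hi a a m) (hi a m s)).symm
  have h2 : ∫ σ in m..s, (k σ - k a) = potential k m s + (s - m) * (k m - k a) := by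
    rw [potential, ← smul_eq_mul, ← intervalIntegral.integral_const,
      ← intervalIntegral.integral_add (hi m m s) (by simp)]
    congr 1
    ext σ
    ring
  linarith [potential_nonneg hmono a m, potential_nonneg hmono m s]

theorem potential_pos (hk : Continuous k) (hmono : StrictMono k) {a s : ℝ} (h : s ≠ a) :
    0 < potential k a s := by
  refine lt_of_lt_of_le ?_ (le_potential hk hmono.monotone a ((a + s) / 2) s)
  rcases lt_or_gt_of_ne h with h | h
  · exact mul_pos_of_neg_of_neg (by linarith) (sub_neg.2 (hmono (by linarith)))
  · exact mul_pos (by linarith) (sub_pos.2 (hmono (by linarith)))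

theorem tendsto_potential_cocompact (hk : Continuous k) (hmono : StrictMono k) (a : ℝ) :
    Tendsto (potential k a) (cocompact ℝ) atTop := by
  rw [cocompact_eq_atBot_atTop, tendsto_sup]
  constructor
  · refine tendsto_atTop_mono (le_potential hk hmono.monotone a (a - 1)) ?_
    exact (tendsto_atBot_add_const_right _ _ tendsto_id).atBot_mul_const_of_neg
      (sub_neg.2 (hmono (by linarith)))
  · refine tendsto_atTop_mono (le_potential hk hmono.monotone a (a + 1)) ?_
    exact (tendsto_atTop_add_const_right _ _ tendsto_id).atTop_mul_const
      (sub_pos.2 (hmono (by linarith)))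

end Potential

section Separable

variable {ι : Type*} [Fintype ι] {T : ι → ℝ} {k : ι → ℝ → ℝ} {R : (ι → ℝ) → ι → ℝ}

/-- Weighted sum of the potentials of all components. -/
noncomputable def separablePotential (T : ι → ℝ) (k : ι → ℝ → ℝ) (e z : ι → ℝ) : ℝ :=
  ∑ i, T i * potential (k i) (e i) (z i)

/-- The derivative of the separable potential. -/
noncomputable def separableGradient (T : ι → ℝ) (k : ι → ℝ → ℝ) (e z : ι → ℝ) :
    (ι → ℝ) →L[ℝ] ℝ :=
  ∑ i, (T i * (k i (z i) - k i (e i))) • ContinuousLinearMap.proj i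

theorem hasFDerivAt_separablePotential (hk : ∀ i, Continuous (k i)) (e z : ι → ℝ) :
    HasFDerivAt (separablePotential T k e) (separableGradient T k e z) z := by
  refine HasFDerivAt.fun_sum fun i _ => ?_
  have h := (hasDerivAt_potential (hk i) (e i) (z i)).const_mul (T i)
  exact h.comp_hasFDerivAt (f := fun z : ι → ℝ => z i) z (hasFDerivAt_apply i z)

/-- Leaving compact sets of a finite product means that some coordinate does so, and the sum
dominates each of its nonnegative terms. -/
theorem tendsto_separablePotential (hT : ∀ i, 0 < T i) (hk : ∀ i, Continuous (k i))
    (hmono : ∀ i, StrictMono (k i)) (e : ι → ℝ) :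
    Tendsto (separablePotential T k e) (cocompact (ι → ℝ)) atTop := by
  rw [← Filter.coprodᵢ_cocompact, Filter.coprodᵢ, tendsto_iSup]
  intro i
  refine tendsto_atTop_mono (fun z => ?_)
    (((tendsto_potential_cocompact (hk i) (hmono i) (e i)).const_mul_atTop (hT i)).comp
      tendsto_comap)
  exact Finset.single_le_sum (f := fun i => T i * potential (k i) (e i) (z i))
    (fun j _ => mul_nonneg (hT j).le (potential_nonneg (hmono j).monotone _ _))
    (Finset.mem_univ i)

theorem eq_of_separablePotential_eq_zero (hT : ∀ i, 0 < T i) (hk : ∀ i, Continuous (k i))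
    (hmono : ∀ i, StrictMono (k i)) {e z : ι → ℝ} (h : separablePotential T k e z = 0) :
    z = e := by
  funext i
  by_contra hne
  have h0 := (Finset.sum_eq_zero_iff_of_nonneg fun j _ =>
    mul_nonneg (hT j).le (potential_nonneg (hmono j).monotone _ _)).1 h i (Finset.mem_univ i)
  exact (mul_pos (hT i) (potential_pos (hk i) (hmono i) hne)).ne' h0

/-- The weights of the potential cancel the time constants in `ż = R(z) / T`. -/
theorem separableGradient_apply (hT : ∀ i, 0 < T i) (e z v : ι → ℝ) :
    separableGradient T k e z (fun i => v i / T i) = ∑ i, (k i (z i) - k i (e i)) * v i := by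
  simp only [separableGradient, sum_apply, smul_apply,
    ContinuousLinearMap.proj_apply, smul_eq_mul]
  refine Finset.sum_congr rfl fun i _ => ?_
  have := (hT i).ne'
  field_simp

theorem isLyapunovFunction_separablePotential (hT : ∀ i, 0 < T i) (hk : ∀ i, Continuous (k i))
    (hmono : ∀ i, StrictMono (k i)) {e : ι → ℝ}
    (hdiss : ∀ z, ∑ i, (k i (z i) - k i (e i)) * R z i ≤ 0) :
    IsLyapunovFunction (fun z i => R z i / T i) (separablePotential T k e)
      (separableGradient T k e) where
  hasFDerivAt := hasFDerivAt_separablePotential hk e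
  nonpos z := by
    rw [separableGradient_apply hT]
    exact hdiss z
  coercive := tendsto_separablePotential hT hk hmono e

theorem contDiff_div_const_pi (hR : ContDiff ℝ 1 R) :
    ContDiff ℝ 1 (fun z i => R z i / T i) :=
  contDiff_pi.2 fun i => (contDiff_pi.1 hR i).div_const (T i)

/-- The system `T ż = R(z)` has global solutions if it dissipates a separable potential. -/
theorem exists_solution_of_dissipative (hT : ∀ i, 0 < T i) (hk : ∀ i, Continuous (k i))
    (hmono : ∀ i, StrictMono (k i)) (hR : ContDiff ℝ 1 R) {e : ι → ℝ}
    (hdiss : ∀ z, ∑ i, (k i (z i) - k i (e i)) * R z i ≤ 0) (z₀ : ι → ℝ) :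
    ∃ w : ℝ → ι → ℝ, w 0 = z₀ ∧
      IsIntegralCurveOn w (fun _ z i => R z i / T i) (Set.Ici 0) :=
  (isLyapunovFunction_separablePotential hT hk hmono hdiss).exists_isIntegralCurveOn_Ici
    (contDiff_div_const_pi hR) z₀

/-- The solutions of a system `T ż = R(z)` converge to equilibria if the separable potential of
every equilibrium is dissipated, strictly so outside the set of equilibria in the sense of
LaSalle's principle. -/
theorem exists_tendsto_of_dissipative (hT : ∀ i, 0 < T i) (hk : ∀ i, Continuous (k i))
    (hmono : ∀ i, StrictMono (k i)) (hR : ContDiff ℝ 1 R)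
    (hdiss : ∀ e, R e = 0 → ∀ z, ∑ i, (k i (z i) - k i (e i)) * R z i ≤ 0)
    (hinv : ∀ e, R e = 0 → ∀ v : ℝ → ι → ℝ,
      IsIntegralCurveOn v (fun _ z i => R z i / T i) (Set.Ici 0) →
      (∀ t, 0 ≤ t → ∑ i, (k i (v t i) - k i (e i)) * R (v t) i = 0) → R (v 0) = 0)
    (hex : ∃ e, R e = 0) {w : ℝ → ι → ℝ}
    (hw : IsIntegralCurveOn w (fun _ z i => R z i / T i) (Set.Ici 0)) :
    ∃ a, R a = 0 ∧ Tendsto w atTop (𝓝 a) := by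
  have hzero : ∀ z, (fun i => R z i / T i) = 0 ↔ R z = 0 := fun z => by
    simp [funext_iff, (hT _).ne']
  simp only [← hzero] at hdiss hinv hex ⊢
  refine IsLyapunovFunction.exists_tendsto_equilibrium (contDiff_div_const_pi hR)
    (fun e he => isLyapunovFunction_separablePotential hT hk hmono (hdiss e he))
    (fun e => by simp [separablePotential])
    (fun e z => eq_of_separablePotential_eq_zero hT hk hmono)
    (fun e he v hv h => hinv e he v hv fun t ht => ?_) hex hw
  rw [← separableGradient_apply hT]
  exact h t ht

end Separable

/-! ### Incidence matrices, location matrices and Laplacians -/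

namespace OrientedGraph

variable {V K : Type*} [Fintype V] [DecidableEq V]

theorem incidence_transpose_mulVec (G : OrientedGraph V K) (y : V → ℝ) (k : K) :
    (G.incidenceᵀ *ᵥ y) k = y (G.pos k) - y (G.neg k) := by
  have h : ∀ i, G.incidence i k * y i =
      (if i = G.pos k then y i else 0) - (if i = G.neg k then y i else 0) := by
    intro i
    have := G.pos_ne_neg k
    unfold incidence
    split_ifs <;> simp_all
  simp [Matrix.mulVec, dotProduct, h, Finset.sum_sub_distrib]

theorem sum_incidence_mulVec [Fintype K] (G : OrientedGraph V K) (v : K → ℝ) :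
    ∑ i, (G.incidence *ᵥ v) i = 0 := by
  have h : G.incidenceᵀ *ᵥ (1 : V → ℝ) = 0 := by
    ext k
    simp [incidence_transpose_mulVec]
  rw [← one_dotProduct, Matrix.dotProduct_mulVec, ← Matrix.mulVec_transpose, h, zero_dotProduct]

theorem eq_of_incidence_transpose_mulVec_eq_zero {G : OrientedGraph V K}
    (hG : G.toSimpleGraph.Connected) {y : V → ℝ} (hy : G.incidenceᵀ *ᵥ y = 0) (i j : V) :
    y i = y j := by
  have hk : ∀ k, y (G.pos k) = y (G.neg k) := fun k => by
    have := congrFun hy k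
    rw [incidence_transpose_mulVec] at this
    exact sub_eq_zero.1 this
  have hadj : ∀ i j, G.toSimpleGraph.Adj i j → y i = y j := by
    intro i j h
    rw [toSimpleGraph, SimpleGraph.fromRel_adj] at h
    obtain ⟨-, ⟨k, rfl, rfl⟩ | ⟨k, rfl, rfl⟩⟩ := h
    exacts [hk k, (hk k).symm]
  obtain ⟨p⟩ := hG.preconnected i j
  induction p with
  | nil => rfl
  | cons h _ ih => exact (hadj _ _ h).trans ih

end OrientedGraph

/-- A vector which is orthogonal to `ker Aᵀ` is reproduced by `A A†`. -/
theorem IsMoorePenroseInverse.mulVec_mulVec_eq {m n : Type*} [Fintype m] [Fintype n]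
    {A : Matrix m n ℝ} {X : Matrix n m ℝ} (h : IsMoorePenroseInverse A X) {b : m → ℝ}
    (hb : ∀ c, Aᵀ *ᵥ c = 0 → c ⬝ᵥ b = 0) : A *ᵥ X *ᵥ b = b := by
  -- The residual lies in `ker Aᵀ`. It is thus orthogonal to the range of `A` and, by hypothesis, to
  -- `b`, hence to itself.
  have hc : Aᵀ *ᵥ (b - A *ᵥ X *ᵥ b) = 0 := by
    have h1 : Aᵀ * (A * X) = Aᵀ := by
      rw [← h.left_symm, ← Matrix.transpose_mul, h.mul_mul_self]
    rw [Matrix.mulVec_sub, Matrix.mulVec_mulVec, Matrix.mulVec_mulVec, Matrix.mul_assoc,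
      h1, sub_self]
  have h2 : (b - A *ᵥ X *ᵥ b) ⬝ᵥ (b - A *ᵥ X *ᵥ b) = 0 := by
    rw [dotProduct_sub, hb _ hc, Matrix.dotProduct_mulVec, ← Matrix.mulVec_transpose, hc,
      zero_dotProduct, sub_zero]
  exact (sub_eq_zero.1 (dotProduct_self_eq_zero.1 h2)).symm

section Indicator

variable {V : Type*} [DecidableEq V] [Fintype V] (S : Finset V)

@[simp] theorem indicatorMatrix_transpose_mulVec (y : V → ℝ) (i : S) :
    ((indicatorMatrix S)ᵀ *ᵥ y) i = y i := by
  simp [Matrix.mulVec, dotProduct, indicatorMatrix]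

theorem sum_indicatorMatrix_mulVec (u : S → ℝ) :
    ∑ i, (indicatorMatrix S *ᵥ u) i = ∑ i, u i := by
  have h : (indicatorMatrix S)ᵀ *ᵥ (1 : V → ℝ) = 1 := by
    ext i
    simp
  rw [← one_dotProduct, Matrix.dotProduct_mulVec, ← Matrix.mulVec_transpose, h, one_dotProduct]

end Indicator

namespace CommGraph

variable {P : Type*} [Fintype P] {G : CommGraph P}

theorem Balanced.sum_sum_weight_mul (hG : G.Balanced) (a : P → ℝ) :
    ∑ i, ∑ j, G.weight i j * a j = ∑ i, ∑ j, G.weight i j * a i := by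
  rw [Finset.sum_comm]
  simp only [← Finset.sum_mul]
  exact Finset.sum_congr rfl fun i _ => by rw [hG i]

variable [DecidableEq P]

theorem laplacian_mulVec (G : CommGraph P) (v : P → ℝ) (i : P) :
    (G.laplacian *ᵥ v) i = ∑ j, G.weight i j * (v i - v j) := by
  simp only [laplacian, Matrix.sub_mulVec, Pi.sub_apply, Matrix.mulVec_diagonal, mul_sub,
    Finset.sum_sub_distrib, Finset.sum_mul]
  rfl

theorem laplacian_mulVec_eq_zero {v : P → ℝ} (hv : ∀ i j, v i = v j) :
    G.laplacian *ᵥ v = 0 := by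
  ext i
  rw [laplacian_mulVec]
  exact Finset.sum_eq_zero fun j _ => by rw [hv i j, sub_self, mul_zero]

theorem Balanced.sum_laplacian_mulVec (hG : G.Balanced) (v : P → ℝ) :
    ∑ i, (G.laplacian *ᵥ v) i = 0 := by
  simp only [laplacian_mulVec, mul_sub, Finset.sum_sub_distrib]
  rw [hG.sum_sum_weight_mul v, sub_self]

/-- Balance allows the squares to be attached to either end of an edge, so the quadratic form is
that of the symmetrized graph although the weights need not be symmetric. -/
theorem Balanced.dotProduct_laplacian_mulVec (hG : G.Balanced) (v : P → ℝ) :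
    v ⬝ᵥ (G.laplacian *ᵥ v) = 1 / 2 * ∑ i, ∑ j, G.weight i j * (v i - v j) ^ 2 := by
  have h := hG.sum_sum_weight_mul fun i => v i ^ 2
  have h1 : ∀ i, v i * (G.laplacian *ᵥ v) i =
      ∑ j, G.weight i j * v i ^ 2 - ∑ j, G.weight i j * (v i * v j) := fun i => by
    rw [laplacian_mulVec, Finset.mul_sum, ← Finset.sum_sub_distrib]
    exact Finset.sum_congr rfl fun j _ => by ring
  have h2 : ∀ i, ∑ j, G.weight i j * (v i - v j) ^ 2 = ∑ j, G.weight i j * v i ^ 2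
      - 2 * ∑ j, G.weight i j * (v i * v j) + ∑ j, G.weight i j * v j ^ 2 := fun i => by
    rw [Finset.mul_sum, ← Finset.sum_sub_distrib, ← Finset.sum_add_distrib]
    exact Finset.sum_congr rfl fun j _ => by ring
  simp only [dotProduct, h1, h2, Finset.sum_add_distrib, Finset.sum_sub_distrib,
    ← Finset.mul_sum]
  linarith

theorem Balanced.dotProduct_laplacian_mulVec_nonneg (hG : G.Balanced) (v : P → ℝ) :
    0 ≤ v ⬝ᵥ (G.laplacian *ᵥ v) := by
  rw [hG.dotProduct_laplacian_mulVec]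
  have := Finset.sum_nonneg fun i (_ : i ∈ Finset.univ) => Finset.sum_nonneg
    fun j (_ : j ∈ Finset.univ) => mul_nonneg (G.weight_nonneg i j) (sq_nonneg (v i - v j))
  linarith

theorem Balanced.eq_of_dotProduct_laplacian_mulVec_eq_zero (hG : G.Balanced)
    (hs : G.StronglyConnected) {v : P → ℝ} (hv : v ⬝ᵥ (G.laplacian *ᵥ v) = 0) (i j : P) :
    v i = v j := by
  rw [hG.dotProduct_laplacian_mulVec] at hv
  have hn : ∀ i j, 0 ≤ G.weight i j * (v i - v j) ^ 2 := fun i j =>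
    mul_nonneg (G.weight_nonneg i j) (sq_nonneg _)
  have hz : ∀ i j, G.weight i j * (v i - v j) ^ 2 = 0 := fun i j => by
    have h1 := (Finset.sum_eq_zero_iff_of_nonneg fun i _ =>
      Finset.sum_nonneg fun j _ => hn i j).1 (by linarith) i (Finset.mem_univ i)
    exact (Finset.sum_eq_zero_iff_of_nonneg fun j _ => hn i j).1 h1 j (Finset.mem_univ j)
  have hedge : ∀ i j, 0 < G.weight i j → v i = v j := fun i j hw =>
    sub_eq_zero.1 (pow_eq_zero_iff two_ne_zero |>.1 ((mul_eq_zero.1 (hz i j)).resolve_left hw.ne'))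
  induction hs i j with
  | refl => rfl
  | tail _ h ih => exact ih.trans (hedge _ _ h)

theorem Balanced.eq_of_laplacian_mulVec_eq_zero (hG : G.Balanced) (hs : G.StronglyConnected)
    {v : P → ℝ} (hv : G.laplacian *ᵥ v = 0) (i j : P) : v i = v j :=
  hG.eq_of_dotProduct_laplacian_mulVec_eq_zero hs (by rw [hv, dotProduct_zero]) i j

end CommGraph

/-! ### The optimal input and the steady states -/

namespace InputCost

variable {P : Type*} [Fintype P]

theorem sum_inv_q_pos [Nonempty P] (c : InputCost P) : 0 < ∑ i, 1 / c.q i :=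
  Finset.sum_pos (fun i _ => one_div_pos.2 (c.q_pos i)) Finset.univ_nonempty

/-- Inputs with equal marginal costs minimize the total cost among all inputs with the same sum. -/
theorem total_lt_total {c : InputCost P} {u u' : P → ℝ} {κ : ℝ}
    (hκ : ∀ i, c.q i * u i + c.r i = κ) (hsum : ∑ i, u' i = ∑ i, u i) (hne : u' ≠ u) :
    c.total u < c.total u' := by
  obtain ⟨j, hj⟩ := Function.ne_iff.1 hne
  have h1 : c.total u' - c.total u = ∑ i, 1 / 2 * c.q i * (u' i - u i) ^ 2 := by
    -- The first-order term of the exact quadratic expansion: with equal marginal costs it only sees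
    -- the change of the total input, which is zero.
    have h2 : ∑ i, κ * (u' i - u i) = 0 := by
      rw [← Finset.mul_sum, Finset.sum_sub_distrib, hsum, sub_self, mul_zero]
    rw [total, total, ← Finset.sum_sub_distrib, ← add_zero (∑ i, _ * _), ← h2,
      ← Finset.sum_add_distrib]
    refine Finset.sum_congr rfl fun i _ => ?_
    rw [← hκ i]
    ring
  have h2 : 0 < ∑ i, 1 / 2 * c.q i * (u' i - u i) ^ 2 := by
    refine Finset.sum_pos' (fun i _ => ?_) ⟨j, Finset.mem_univ j, ?_⟩
    · have := c.q_pos i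
      positivity
    · have := c.q_pos j
      have := sub_ne_zero.2 hj
      positivity
  linarith

/-- Inputs with equal marginal costs are determined by their sum. -/
theorem eq_of_marginal_eq {c : InputCost P} {u u' : P → ℝ}
    (h : ∀ i j, c.q i * u i + c.r i = c.q j * u j + c.r j)
    (h' : ∀ i j, c.q i * u' i + c.r i = c.q j * u' j + c.r j) (hsum : ∑ i, u' i = ∑ i, u i) :
    u' = u := by
  by_contra hne
  -- An index where the inputs differ supplies the common marginal cost. Each input would then be
  -- strictly cheaper than the other.
  obtain ⟨j, -⟩ := Function.ne_iff.1 hne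
  exact lt_asymm (total_lt_total (fun i => h i j) hsum hne)
    (total_lt_total (fun i => h' i j) hsum.symm (Ne.symm hne))

variable [DecidableEq P]

theorem Q_mulVec (c : InputCost P) (u : P → ℝ) (i : P) : (c.Q *ᵥ u) i = c.q i * u i :=
  Matrix.mulVec_diagonal _ _ _

theorem Q_inv_mulVec (c : InputCost P) (u : P → ℝ) (i : P) : (c.Q⁻¹ *ᵥ u) i = u i / c.q i := by
  have h : c.Q⁻¹ = Matrix.diagonal fun i => (c.q i)⁻¹ := by
    refine Matrix.inv_eq_left_inv ?_
    rw [Q, Matrix.diagonal_mul_diagonal, ← Matrix.diagonal_one]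
    congr 1
    ext i
    exact inv_mul_cancel₀ (c.q_pos i).ne'
  rw [h, Matrix.mulVec_diagonal, div_eq_inv_mul]

theorem Q_mulVec_eq_zero {c : InputCost P} {u : P → ℝ} (h : c.Q *ᵥ u = 0) : u = 0 := by
  ext i
  have := congrFun h i
  rw [Q_mulVec] at this
  exact (mul_eq_zero.1 this).resolve_left (c.q_pos i).ne'

end InputCost

namespace FlowNetwork

theorem output_injective {V K Kc : Type*} (N : FlowNetwork V K Kc) : Function.Injective N.output :=
  fun _ _ h => funext fun i => (N.h_strictMono i).injective (congrFun h i)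

variable {V K Kc : Type*} [Fintype V] [DecidableEq V]
  {N : FlowNetwork V K Kc} {c : InputCost N.actuated}

theorem kappaHat_apply (N : FlowNetwork V K Kc) (c : InputCost N.actuated) (xbar : V → ℝ)
    (i : N.actuated) :
    N.kappaHat c xbar i =
      (∑ j, N.dHat xbar j + ∑ j, c.r j / c.q j) / ∑ j, 1 / c.q j := by
  have h1 : (1 : N.actuated → ℝ) ⬝ᵥ (c.Q⁻¹ *ᵥ 1) = ∑ j, 1 / c.q j := by
    simp [one_dotProduct, c.Q_inv_mulVec]
  have h2 : (1 : V → ℝ) ⬝ᵥ (N.dHat xbar + N.E *ᵥ c.Q⁻¹ *ᵥ c.r) =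
      ∑ j, N.dHat xbar j + ∑ j, c.r j / c.q j := by
    rw [dotProduct_add, one_dotProduct, one_dotProduct, E, sum_indicatorMatrix_mulVec]
    simp only [c.Q_inv_mulVec]
  rw [kappaHat, E, indicatorMatrix_transpose_mulVec, h1, Matrix.smul_mulVec,
    Matrix.vecMulVec_mulVec, ← E, h2]
  simp [div_eq_inv_mul]

/-- The value does not depend on `i`. It is the Lagrange multiplier of the constraint on the total
input. -/
theorem q_mul_uHat_add_r (N : FlowNetwork V K Kc) (c : InputCost N.actuated) (xbar : V → ℝ)
    (i : N.actuated) : c.q i * N.uHat c xbar i + c.r i =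
      (∑ j, N.dHat xbar j + ∑ j, c.r j / c.q j) / ∑ j, 1 / c.q j := by
  rw [uHat, c.Q_inv_mulVec, Pi.sub_apply, kappaHat_apply, mul_div_cancel₀ _ (c.q_pos i).ne',
    sub_add_cancel]

theorem sum_uHat (N : FlowNetwork V K Kc) (c : InputCost N.actuated)
    (hinput : N.actuated.Nonempty) (xbar : V → ℝ) :
    ∑ i, N.uHat c xbar i = ∑ j, N.dHat xbar j := by
  have := hinput.to_subtype
  have hpos := c.sum_inv_q_pos
  have h : ∀ i, N.uHat c xbar i =
      (∑ j, N.dHat xbar j + ∑ j, c.r j / c.q j) / (∑ j, 1 / c.q j) * (1 / c.q i)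
        - c.r i / c.q i := by
    intro i
    rw [← q_mul_uHat_add_r N c xbar i]
    have := (c.q_pos i).ne'
    field_simp
    ring
  simp only [h, Finset.sum_sub_distrib, ← Finset.mul_sum]
  rw [div_mul_cancel₀ _ hpos.ne']
  ring

variable [Fintype Kc]

/-- Flows on compartmental edges cancel in the network total; only the in/outflows, which `dHat`
includes, remain. -/
theorem sum_Psi (N : FlowNetwork V K Kc) (x : V → ℝ) :
    ∑ i, (N.Psi x i - N.d i) = -∑ i, N.dHat x i := by
  have h : ∑ i, (N.Bc *ᵥ fun k => N.γ k ((N.Bcᵀ *ᵥ N.output x) k)) i = 0 :=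
    N.compGraph.sum_incidence_mulVec _
  simp only [Psi, dHat, Pi.sub_apply, Pi.neg_apply, Pi.add_apply, Finset.sum_sub_distrib,
    Finset.sum_add_distrib, Finset.sum_neg_distrib]
  rw [h]
  ring

variable [Fintype K]

/-- Summing the balance over all nodes removes the edge flows. On a connected graph this necessary
condition is also sufficient, by `steadyInput_pinv`. -/
theorem SteadyInput.sum_eq {xbar : V → ℝ} {u : N.actuated → ℝ} {lam : K → ℝ}
    (h : N.SteadyInput xbar u lam) : ∑ i, u i = ∑ i, N.dHat xbar i := by
  have h1 : ∑ i, ((N.Psi xbar i - N.d i) - (N.B *ᵥ lam) i + (N.E *ᵥ u) i) = 0 := by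
    refine Finset.sum_eq_zero fun i _ => ?_
    have := congrFun h i
    simp only [Pi.zero_apply, Pi.add_apply, Pi.sub_apply] at this
    linarith
  have h2 := sum_indicatorMatrix_mulVec N.actuated u
  have h3 := N.graph.sum_incidence_mulVec lam
  rw [Finset.sum_add_distrib, Finset.sum_sub_distrib, sum_Psi, B, E, h2, h3] at h1
  linarith

/-- On a connected graph, the flows `B† (Ψ + E u - d) + (1 - B† B) ω` balance every input which
balances the disturbance. -/
theorem steadyInput_pinv [DecidableEq K] (hconn : N.graph.toSimpleGraph.Connected)
    {xbar : V → ℝ} {u : N.actuated → ℝ} (hu : ∑ i, u i = ∑ i, N.dHat xbar i) (ω : K → ℝ) :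
    N.SteadyInput xbar u
      (pinv N.B *ᵥ (N.Psi xbar + N.E *ᵥ u - N.d) + (1 - pinv N.B * N.B) *ᵥ ω) := by
  have hpinv := pinv_spec N.B
  have hsum : ∑ i, (N.Psi xbar + N.E *ᵥ u - N.d) i = 0 := by
    have h1 := sum_Psi N xbar
    have h2 := sum_indicatorMatrix_mulVec N.actuated u
    simp only [Pi.sub_apply, Pi.add_apply, Finset.sum_sub_distrib, Finset.sum_add_distrib,
      E] at h1 ⊢
    linarith
  -- By connectedness `ker Bᵀ` consists of constant vectors, to which a vector with zero sum is
  -- orthogonal.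
  have h1 : N.B *ᵥ pinv N.B *ᵥ (N.Psi xbar + N.E *ᵥ u - N.d) =
      N.Psi xbar + N.E *ᵥ u - N.d := by
    refine hpinv.mulVec_mulVec_eq fun y hy => ?_
    obtain ⟨j⟩ := hconn.nonempty
    have hy' := fun i => OrientedGraph.eq_of_incidence_transpose_mulVec_eq_zero hconn hy i j
    simp only [dotProduct, hy', ← Finset.mul_sum, hsum, mul_zero]
  have h2 : N.B *ᵥ (1 - pinv N.B * N.B) *ᵥ ω = 0 := by
    rw [Matrix.mulVec_mulVec, Matrix.mul_sub, Matrix.mul_one, ← Matrix.mul_assoc,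
      hpinv.mul_mul_self, sub_self, Matrix.zero_mulVec]
  rw [SteadyInput, Matrix.mulVec_add, h1, h2]
  abel

theorem isOptimalInput_uHat (hconn : N.graph.toSimpleGraph.Connected)
    (hinput : N.actuated.Nonempty) (xbar : V → ℝ) :
    N.IsOptimalInput c xbar (N.uHat c xbar) := by
  classical
  refine ⟨⟨_, steadyInput_pinv hconn (sum_uHat N c hinput xbar) 0⟩, fun u' lam' h hne => ?_⟩
  exact InputCost.total_lt_total (q_mul_uHat_add_r N c xbar)
    (h.sum_eq.trans (sum_uHat N c hinput xbar).symm) hne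

variable {C : Controller K N.actuated}

theorem isEquilibrium_iff {ybar : V → ℝ} {e : State V K N.actuated} :
    N.IsEquilibrium c C ybar e ↔ (N.rhs c C ybar e).x = 0 ∧ (N.rhs c C ybar e).μ = 0 ∧
      (N.rhs c C ybar e).ξ = 0 ∧ (N.rhs c C ybar e).θ = 0 ∧ (N.rhs c C ybar e).φ = 0 := by
  rw [IsEquilibrium, State.ext_iff]

theorem isEquilibrium_of_steadyInput {xbar ybar : V → ℝ} (hset : N.output xbar = ybar)
    {e : State V K N.actuated} (hx : e.x = xbar) (hξ : C.flow e.μ = e.ξ)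
    (hθ : C.input e.θ = N.uHat c xbar) (hφ : e.φ = N.uHat c xbar)
    (hs : N.SteadyInput xbar (N.uHat c xbar) (C.flow e.μ)) : N.IsEquilibrium c C ybar e := by
  have hL : C.comm.laplacian *ᵥ (c.Q *ᵥ N.uHat c xbar + c.r) = 0 :=
    CommGraph.laplacian_mulVec_eq_zero fun i j => by
      simp only [Pi.add_apply, c.Q_mulVec, q_mul_uHat_add_r]
  rw [isEquilibrium_iff]
  refine ⟨?_, ?_, ?_, ?_, ?_⟩
  · simp only [rhs]
    rw [hx, hθ]
    exact hs.symm
  · simp [rhs, hx, hset, hξ]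
  · simp [rhs, hξ]
  · simp [rhs, hx, hset, hθ, hφ]
  · simp [rhs, hθ, hφ, hL]

theorem exists_isEquilibrium [DecidableEq K] (hconn : N.graph.toSimpleGraph.Connected)
    (hinput : N.actuated.Nonempty) {xbar ybar : V → ℝ} (hset : N.output xbar = ybar)
    (hatt : N.Attainable c C xbar) : ∃ e, N.IsEquilibrium c C ybar e := by
  obtain ⟨⟨ω, hω⟩, hu⟩ := hatt
  choose μ hμ using hω
  choose θ hθ using hu
  have hs := steadyInput_pinv hconn (sum_uHat N c hinput xbar) ω
  rw [← (funext hμ : C.flow μ = _)] at hs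
  exact ⟨⟨xbar, μ, C.flow μ, θ, N.uHat c xbar⟩,
    isEquilibrium_of_steadyInput hset rfl rfl (funext hθ) rfl hs⟩

/-- All equilibria have the state `xbar` and the optimal input. -/
theorem IsEquilibrium.eq_and_steadyInput (hconn : N.graph.toSimpleGraph.Connected)
    (hinput : N.actuated.Nonempty) (hbal : C.comm.Balanced) (hstrong : C.comm.StronglyConnected)
    {xbar ybar : V → ℝ} (hset : N.output xbar = ybar) {e : State V K N.actuated}
    (he : N.IsEquilibrium c C ybar e) :
    e.x = xbar ∧ C.flow e.μ = e.ξ ∧ C.input e.θ = N.uHat c xbar ∧ e.φ = N.uHat c xbar ∧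
      N.SteadyInput xbar (N.uHat c xbar) (C.flow e.μ) := by
  have := hinput.to_subtype
  obtain ⟨hx, hμ, hξ, hθ, hφ⟩ := isEquilibrium_iff.1 he
  simp only [rhs] at hx hμ hξ hθ hφ
  have hflow : C.flow e.μ = e.ξ := sub_eq_zero.1 hξ
  rw [hflow, sub_self, sub_zero] at hμ
  set L := C.comm.laplacian *ᵥ (c.Q *ᵥ e.φ + c.r) with hLdef
  obtain ⟨j⟩ := hconn.nonempty
  have hα : ∀ i, (N.output e.x - ybar) i = (N.output e.x - ybar) j := fun i =>
    OrientedGraph.eq_of_incidence_transpose_mulVec_eq_zero hconn hμ i j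
  set α := (N.output e.x - ybar) j
  -- The `θ` equation gives `g(θ) - φ = -α` at each actuated node, and the `φ` equation equates the
  -- same difference with `q L`.
  have hL : ∀ i, L i = -α * (1 / c.q i) := fun i => by
    have h1 := congrFun hθ i
    have h2 := congrFun hφ i
    simp only [E, Pi.sub_apply, Pi.neg_apply, indicatorMatrix_transpose_mulVec, Pi.zero_apply,
      c.Q_mulVec] at h1 h2
    have h3 := hα i
    simp only [Pi.sub_apply] at h3
    have := (c.q_pos i).ne'
    field_simp
    linarith
  -- A balanced Laplacian has zero column sums, while the sum of the `1 / q i` is positive.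
  have hα0 : α = 0 := by
    have h1 : ∑ i, L i = 0 := hbal.sum_laplacian_mulVec _
    simp only [hL, ← Finset.mul_sum] at h1
    linarith [(mul_eq_zero.1 h1).resolve_right c.sum_inv_q_pos.ne']
  have hy : N.output e.x = ybar := funext fun i => sub_eq_zero.1 ((hα i).trans hα0)
  have hxe : e.x = xbar := N.output_injective (hy.trans hset.symm)
  have hL0 : L = 0 := funext fun i => by simp [hL, hα0]
  rw [hL0, Matrix.mulVec_zero, sub_zero] at hφ
  have hinp : C.input e.θ = e.φ := sub_eq_zero.1 hφ
  have hs : N.SteadyInput xbar e.φ (C.flow e.μ) := by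
    rw [SteadyInput, ← hx, hxe, hinp]
  have hu : e.φ = N.uHat c xbar := by
    refine InputCost.eq_of_marginal_eq (c := c) (fun i j => ?_) (fun i j => ?_)
      (hs.sum_eq.trans (sum_uHat N c hinput xbar).symm)
    · rw [q_mul_uHat_add_r, q_mul_uHat_add_r]
    · have := hbal.eq_of_laplacian_mulVec_eq_zero hstrong hL0 i j
      simpa only [Pi.add_apply, c.Q_mulVec] using this
  exact ⟨hxe, hflow, hinp.trans hu, hu, hu ▸ hs⟩

end FlowNetwork

/-! ### The closed loop as a dissipative system -/

namespace State

variable {V K P : Type*}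

/-- The vector of all components of a state. -/
def toVec (z : State V K P) : V ⊕ K ⊕ K ⊕ P ⊕ P → ℝ :=
  Sum.elim z.x (Sum.elim z.μ (Sum.elim z.ξ (Sum.elim z.θ z.φ)))

/-- The state with given components. -/
def ofVec (w : V ⊕ K ⊕ K ⊕ P ⊕ P → ℝ) : State V K P where
  x i := w (.inl i)
  μ k := w (.inr (.inl k))
  ξ k := w (.inr (.inr (.inl k)))
  θ i := w (.inr (.inr (.inr (.inl i))))
  φ i := w (.inr (.inr (.inr (.inr i))))

@[simp] theorem ofVec_toVec (z : State V K P) : ofVec z.toVec = z := rfl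

@[simp] theorem toVec_ofVec (w : V ⊕ K ⊕ K ⊕ P ⊕ P → ℝ) : (ofVec w).toVec = w := by
  ext (i | i | i | i | i) <;> rfl

theorem convergesTo_iff {z : ℝ → State V K P} {a : State V K P} :
    ConvergesTo z a ↔ Tendsto (fun t => (z t).toVec) atTop (𝓝 a.toVec) := by
  simp only [ConvergesTo, tendsto_pi_nhds, Sum.forall]
  rfl

end State

/-! ### Auxiliary facts on derivatives, monotone maps and smoothness -/

theorem eq_of_hasDerivWithinAt_zero {f : ℝ → ℝ}
    (hf : ∀ t, 0 ≤ t → HasDerivWithinAt f 0 (Set.Ici 0) t) {t : ℝ} (ht : 0 ≤ t) : f t = f 0 :=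
  constant_of_has_deriv_right_zero
    (fun s hs => (hf s hs.1).continuousWithinAt.mono Set.Icc_subset_Ici_self)
    (fun s hs => (hf s hs.1).mono (Set.Ici_subset_Ici.2 hs.1)) t (Set.right_mem_Icc.2 ht)

theorem deriv_eq_zero_of_forall_eq {f : ℝ → ℝ} {a f' t : ℝ} (hf : ∀ t, 0 ≤ t → f t = a)
    (ht : 0 ≤ t) (h : HasDerivWithinAt f f' (Set.Ici 0) t) : f' = 0 :=
  (uniqueDiffOn_Ici (0 : ℝ) t ht).eq_deriv _ h
    ((hasDerivWithinAt_const t _ a).congr (fun s hs => hf s hs) (hf t ht))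

theorem contDiff_reindex {m n : Type*} [Fintype m] [Fintype n] {r : WithTop ℕ∞} (s : n → m) :
    ContDiff ℝ r fun (w : m → ℝ) (i : n) => w (s i) :=
  contDiff_pi.2 fun i => contDiff_apply ℝ ℝ (s i)

theorem Matrix.diagonal_mulVec_eq_iff {n : Type*} [Fintype n] [DecidableEq n] {T v r : n → ℝ}
    (hT : ∀ i, 0 < T i) : Matrix.diagonal T *ᵥ v = r ↔ v = fun i => r i / T i := by
  simp only [funext_iff, Matrix.mulVec_diagonal, eq_div_iff (hT _).ne', mul_comm]

/-- Moving `A` to the other factor leaves a sum of products of an increment with the increment of a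
monotone function, which have equal sign. -/
theorem Matrix.dotProduct_mulVec_monotone_nonneg {m n : Type*} [Fintype m] [Fintype n]
    (A : Matrix m n ℝ) {k : n → ℝ → ℝ} (hk : ∀ i, Monotone (k i)) (y y' : m → ℝ) :
    0 ≤ (y - y') ⬝ᵥ (A *ᵥ fun i => k i ((Aᵀ *ᵥ y) i)) -
      (y - y') ⬝ᵥ (A *ᵥ fun i => k i ((Aᵀ *ᵥ y') i)) := by
  rw [← dotProduct_sub, ← Matrix.mulVec_sub, Matrix.dotProduct_mulVec,
    ← Matrix.mulVec_transpose, Matrix.mulVec_sub]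
  refine Finset.sum_nonneg fun i _ => ?_
  simp only [Pi.sub_apply]
  rcases le_total ((Aᵀ *ᵥ y) i) ((Aᵀ *ᵥ y') i) with h | h
  · exact mul_nonneg_of_nonpos_of_nonpos (sub_nonpos.2 h) (sub_nonpos.2 (hk i h))
  · exact mul_nonneg (sub_nonneg.2 h) (sub_nonneg.2 (hk i h))

theorem ContDiff.matrix_mulVec {E m n : Type*} [NormedAddCommGroup E] [NormedSpace ℝ E]
    [Fintype m] [Fintype n] {r : WithTop ℕ∞} (A : Matrix m n ℝ) {g : E → n → ℝ}
    (hg : ContDiff ℝ r g) : ContDiff ℝ r fun z => A *ᵥ g z :=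
  (LinearMap.toContinuousLinearMap A.mulVecLin).contDiff.comp hg

theorem ContDiff.componentwise {E n : Type*} [NormedAddCommGroup E] [NormedSpace ℝ E]
    [Fintype n] {r : WithTop ℕ∞} {k : n → ℝ → ℝ} (hk : ∀ i, ContDiff ℝ r (k i)) {g : E → n → ℝ}
    (hg : ContDiff ℝ r g) : ContDiff ℝ r fun z i => k i (g z i) :=
  contDiff_pi.2 fun i => (hk i).comp (contDiff_pi.1 hg i)

namespace FlowNetwork

variable {V K Kc : Type*}

/-- The time constants of the closed loop. -/
def timeConstants (N : FlowNetwork V K Kc) (C : Controller K N.actuated) :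
    V ⊕ K ⊕ K ⊕ N.actuated ⊕ N.actuated → ℝ :=
  State.toVec ⟨N.Tx, C.Tμ, C.Tξ, C.Tθ, C.Tφ⟩

theorem timeConstants_pos (N : FlowNetwork V K Kc) (C : Controller K N.actuated)
    (i : V ⊕ K ⊕ K ⊕ N.actuated ⊕ N.actuated) : 0 < N.timeConstants C i := by
  rcases i with i | i | i | i | i
  exacts [N.Tx_pos i, C.Tμ_pos i, C.Tξ_pos i, C.Tθ_pos i, C.Tφ_pos i]

/-- The functions whose primitives are the components of the storage function. -/
def storageMaps (N : FlowNetwork V K Kc) (C : Controller K N.actuated) :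
    V ⊕ K ⊕ K ⊕ N.actuated ⊕ N.actuated → ℝ → ℝ :=
  Sum.elim N.h (Sum.elim C.f (Sum.elim (fun _ => id) (Sum.elim C.g (fun _ => id))))

theorem continuous_storageMaps (N : FlowNetwork V K Kc) {C : Controller K N.actuated}
    (hf : ∀ k, Continuous (C.f k)) (hg : ∀ i, Continuous (C.g i))
    (i : V ⊕ K ⊕ K ⊕ N.actuated ⊕ N.actuated) : Continuous (N.storageMaps C i) := by
  rcases i with i | i | i | i | i
  exacts [(N.h_contDiff i).continuous, hf i, continuous_id, hg i, continuous_id]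

theorem strictMono_storageMaps (N : FlowNetwork V K Kc) {C : Controller K N.actuated}
    (hf : ∀ k, StrictMono (C.f k)) (hg : ∀ i, StrictMono (C.g i))
    (i : V ⊕ K ⊕ K ⊕ N.actuated ⊕ N.actuated) : StrictMono (N.storageMaps C i) := by
  rcases i with i | i | i | i | i
  exacts [N.h_strictMono i, hf i, strictMono_id, hg i, strictMono_id]

variable [Fintype V] [DecidableEq V] [Fintype Kc]

/-- The compartmental dynamics are incrementally passive. -/
theorem dotProduct_Psi_sub_nonpos (N : FlowNetwork V K Kc) (x x' : V → ℝ) :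
    (N.output x - N.output x') ⬝ᵥ (N.Psi x - N.Psi x') ≤ 0 := by
  have h1 := Matrix.dotProduct_mulVec_monotone_nonneg N.Bc N.γ_mono (N.output x) (N.output x')
  have h2 := Matrix.dotProduct_mulVec_monotone_nonneg N.Ec N.η_mono (N.output x) (N.output x')
  simp only [Psi, dotProduct_sub, dotProduct_neg]
  unfold compFlow
  linarith

variable [Fintype K]
  {N : FlowNetwork V K Kc} {c : InputCost N.actuated} {C : Controller K N.actuated}
  {ybar : V → ℝ}

/-- The right-hand side of the closed loop as a vector field. -/
def vectorField (N : FlowNetwork V K Kc) (c : InputCost N.actuated)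
    (C : Controller K N.actuated) (ybar : V → ℝ) (w : V ⊕ K ⊕ K ⊕ N.actuated ⊕ N.actuated → ℝ) :
    V ⊕ K ⊕ K ⊕ N.actuated ⊕ N.actuated → ℝ :=
  (N.rhs c C ybar (State.ofVec w)).toVec

theorem vectorField_toVec_eq_zero {e : State V K N.actuated} :
    N.vectorField c C ybar e.toVec = 0 ↔ N.IsEquilibrium c C ybar e := by
  rw [isEquilibrium_iff]
  simp only [funext_iff, Sum.forall]
  rfl

theorem isSolution_iff [DecidableEq K] {z : ℝ → State V K N.actuated} :
    N.IsSolution c C ybar z ↔ IsIntegralCurveOn (fun t => (z t).toVec)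
      (fun _ w i => N.vectorField c C ybar w i / N.timeConstants C i) (Set.Ici 0) := by
  refine forall₂_congr fun t _ => ?_
  simp only [Matrix.diagonal_mulVec_eq_iff N.Tx_pos, Matrix.diagonal_mulVec_eq_iff C.Tμ_pos,
    Matrix.diagonal_mulVec_eq_iff C.Tξ_pos, Matrix.diagonal_mulVec_eq_iff C.Tθ_pos,
    Matrix.diagonal_mulVec_eq_iff C.Tφ_pos]
  constructor
  · rintro ⟨z', h1, h2, h3, h4, h5, e1, e2, e3, e4, e5⟩
    rw [e1] at h1
    rw [e2] at h2
    rw [e3] at h3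
    rw [e4] at h4
    rw [e5] at h5
    rw [hasDerivWithinAt_pi] at *
    rintro (i | i | i | i | i)
    exacts [h1 i, h2 i, h3 i, h4 i, h5 i]
  · intro h
    rw [hasDerivWithinAt_pi] at h
    refine ⟨⟨_, _, _, _, _⟩, ?_, ?_, ?_, ?_, ?_, rfl, rfl, rfl, rfl, rfl⟩ <;>
      rw [hasDerivWithinAt_pi] <;> intro i
    exacts [h (.inl i), h (.inr (.inl i)), h (.inr (.inr (.inl i))),
      h (.inr (.inr (.inr (.inl i)))), h (.inr (.inr (.inr (.inr i))))]

theorem contDiff_vectorField (hf : ∀ k, ContDiff ℝ 1 (C.f k)) (hg : ∀ i, ContDiff ℝ 1 (C.g i)) :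
    ContDiff ℝ 1 (N.vectorField c C ybar) := by
  have hout : ContDiff ℝ 1 fun w => N.output (State.ofVec (K := K) (P := N.actuated) w).x :=
    .componentwise N.h_contDiff (contDiff_reindex Sum.inl)
  have hflow : ContDiff ℝ 1 fun w => C.flow (State.ofVec (V := V) (P := N.actuated) w).μ :=
    .componentwise hf (contDiff_reindex fun k => Sum.inr (Sum.inl k))
  have hinp : ContDiff ℝ 1 fun w => C.input (State.ofVec (V := V) (K := K) w).θ :=
    .componentwise hg (contDiff_reindex fun i => Sum.inr (Sum.inr (Sum.inr (Sum.inl i))))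
  have hξ : ContDiff ℝ 1 fun w => (State.ofVec (V := V) (K := K) (P := N.actuated) w).ξ :=
    contDiff_reindex fun i => Sum.inr (Sum.inr (Sum.inl i))
  have hφ : ContDiff ℝ 1 fun w => (State.ofVec (V := V) (K := K) (P := N.actuated) w).φ :=
    contDiff_reindex fun i => Sum.inr (Sum.inr (Sum.inr (Sum.inr i)))
  have hPsi : ContDiff ℝ 1 fun w =>
      N.Psi (State.ofVec (K := K) (P := N.actuated) w).x :=
    ((ContDiff.componentwise N.γ_contDiff (hout.matrix_mulVec N.Bcᵀ)).matrix_mulVec N.Bc).neg.sub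
      ((ContDiff.componentwise N.η_contDiff (hout.matrix_mulVec N.Ecᵀ)).matrix_mulVec N.Ec)
  refine contDiff_pi.2 ?_
  rintro (i | i | i | i | i)
  · exact contDiff_pi.1 (((hPsi.sub (hflow.matrix_mulVec N.B)).add
      (hinp.matrix_mulVec N.E)).sub contDiff_const) i
  · exact contDiff_pi.1 (((hout.sub contDiff_const).matrix_mulVec N.Bᵀ).sub (hflow.sub hξ)) i
  · exact contDiff_pi.1 (hflow.sub hξ) i
  · exact contDiff_pi.1 (((hout.sub contDiff_const).matrix_mulVec N.Eᵀ).neg.sub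
      (hinp.sub hφ)) i
  · exact contDiff_pi.1 ((hinp.sub hφ).sub
      ((((hφ.matrix_mulVec c.Q).add contDiff_const).matrix_mulVec C.comm.laplacian).matrix_mulVec
        c.Q)) i

/-- The dissipation of the storage function of an equilibrium `e`. -/
theorem sum_storageMaps_mul_vectorField {e : State V K N.actuated}
    (he : N.IsEquilibrium c C ybar e) (hy : N.output e.x = ybar) (hξ : C.flow e.μ = e.ξ)
    (hφ : C.input e.θ = e.φ) (z : State V K N.actuated) :
    ∑ i, (N.storageMaps C i (z.toVec i) - N.storageMaps C i (e.toVec i)) *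
        N.vectorField c C ybar z.toVec i =
      (N.output z.x - N.output e.x) ⬝ᵥ (N.Psi z.x - N.Psi e.x)
        - (C.flow z.μ - z.ξ) ⬝ᵥ (C.flow z.μ - z.ξ)
        - (C.input z.θ - z.φ) ⬝ᵥ (C.input z.θ - z.φ)
        - (c.Q *ᵥ (z.φ - e.φ)) ⬝ᵥ (C.comm.laplacian *ᵥ (c.Q *ᵥ (z.φ - e.φ))) := by
  obtain ⟨h1, -, -, -, h5⟩ := isEquilibrium_iff.1 he
  simp only [rhs, hφ, sub_self, zero_sub, neg_eq_zero] at h1 h5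
  have hL := InputCost.Q_mulVec_eq_zero h5
  have hsum : ∑ i, (N.storageMaps C i (z.toVec i) - N.storageMaps C i (e.toVec i)) *
        N.vectorField c C ybar z.toVec i =
      (N.output z.x - N.output e.x) ⬝ᵥ (N.rhs c C ybar z).x +
      ((C.flow z.μ - C.flow e.μ) ⬝ᵥ (N.rhs c C ybar z).μ +
      ((z.ξ - e.ξ) ⬝ᵥ (N.rhs c C ybar z).ξ +
      ((C.input z.θ - C.input e.θ) ⬝ᵥ (N.rhs c C ybar z).θ +
      (z.φ - e.φ) ⬝ᵥ (N.rhs c C ybar z).φ))) := by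
    simp only [Fintype.sum_sum_type]
    rfl
  -- Subtracting the equilibrium equation writes the `x` dynamics in increments, which removes `d`;
  -- `hLz` does the same for `r`.
  have hx : (N.rhs c C ybar z).x = (N.Psi z.x - N.Psi e.x) - N.B *ᵥ (C.flow z.μ - C.flow e.μ)
      + N.E *ᵥ (C.input z.θ - C.input e.θ) := by
    rw [← sub_zero (N.rhs c C ybar z).x, ← h1, Matrix.mulVec_sub, Matrix.mulVec_sub, hφ]
    simp only [rhs]
    abel
  have hLz : C.comm.laplacian *ᵥ (c.Q *ᵥ z.φ + c.r) =
      C.comm.laplacian *ᵥ (c.Q *ᵥ (z.φ - e.φ)) := by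
    rw [← sub_zero (C.comm.laplacian *ᵥ (c.Q *ᵥ z.φ + c.r)), ← hL, ← Matrix.mulVec_sub,
      Matrix.mulVec_sub c.Q, add_sub_add_right_eq_sub]
  have hQ : ∀ u v : N.actuated → ℝ, u ⬝ᵥ (c.Q *ᵥ v) = (c.Q *ᵥ u) ⬝ᵥ v := fun u v => by
    rw [Matrix.dotProduct_mulVec, ← Matrix.mulVec_transpose, InputCost.Q,
      Matrix.diagonal_transpose]
  rw [hsum, hx]
  simp only [rhs, hLz]
  -- Transposing `Bᵀ` and `Eᵀ` produces the coupling terms of the `x` equation with opposite signs,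
  -- so they cancel. Symmetry of `Q` gives the Laplacian form.
  rw [← hy, ← hξ, ← hφ, dotProduct_sub (C.flow z.μ - C.flow e.μ),
    Matrix.dotProduct_transpose_mulVec,
    dotProduct_sub (C.input z.θ - C.input e.θ), dotProduct_neg,
    Matrix.dotProduct_transpose_mulVec,
    dotProduct_sub (z.φ - C.input e.θ), hQ, dotProduct_add, dotProduct_sub (N.output z.x - _)]
  -- With these splittings the contributions of `ξ` and `φ` cancel the mixed terms and only the
  -- negative squares survive.
  have h2 : C.flow z.μ - C.flow e.μ = (C.flow z.μ - z.ξ) + (z.ξ - C.flow e.μ) := by abel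
  have h3 : C.input z.θ - C.input e.θ = (C.input z.θ - z.φ) + (z.φ - C.input e.θ) := by abel
  have h4 := congrArg (· ⬝ᵥ (C.flow z.μ - z.ξ)) h2
  have h6 := congrArg (· ⬝ᵥ (C.input z.θ - z.φ)) h3
  simp only [add_dotProduct] at h4 h6
  rw [h4, h6]
  ring

end FlowNetwork

/-! ### Dissipation inequality and trajectories without dissipation -/

namespace FlowNetwork

variable {V K Kc : Type*} [Fintype V] [DecidableEq V] [Fintype K] [Fintype Kc]
  {N : FlowNetwork V K Kc} {c : InputCost N.actuated} {C : Controller K N.actuated}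
  {xbar ybar : V → ℝ}

theorem sum_storageMaps_mul_vectorField_nonpos (hbal : C.comm.Balanced)
    {e : State V K N.actuated} (he : N.IsEquilibrium c C ybar e) (hy : N.output e.x = ybar)
    (hξ : C.flow e.μ = e.ξ) (hφ : C.input e.θ = e.φ) (z : State V K N.actuated) :
    ∑ i, (N.storageMaps C i (z.toVec i) - N.storageMaps C i (e.toVec i)) *
      N.vectorField c C ybar z.toVec i ≤ 0 := by
  rw [sum_storageMaps_mul_vectorField he hy hξ hφ]
  have h1 := N.dotProduct_Psi_sub_nonpos z.x e.x
  have h2 : 0 ≤ (C.flow z.μ - z.ξ) ⬝ᵥ (C.flow z.μ - z.ξ) :=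
    Finset.sum_nonneg fun _ _ => mul_self_nonneg _
  have h3 : 0 ≤ (C.input z.θ - z.φ) ⬝ᵥ (C.input z.θ - z.φ) :=
    Finset.sum_nonneg fun _ _ => mul_self_nonneg _
  have h4 := hbal.dotProduct_laplacian_mulVec_nonneg (c.Q *ᵥ (z.φ - e.φ))
  linarith

/-- The dissipation is a sum of terms of one sign, so each vanishes. Strong connectedness makes `Q(φ
- φbar)` constant over the nodes. Nothing is extracted from the `Ψ` term, as `γ` and `η` need not be
strictly increasing. -/
theorem eq_of_sum_storageMaps_mul_vectorField_eq_zero (hbal : C.comm.Balanced)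
    (hstrong : C.comm.StronglyConnected)
    {e : State V K N.actuated} (he : N.IsEquilibrium c C ybar e) (hy : N.output e.x = ybar)
    (hξ : C.flow e.μ = e.ξ) (hφ : C.input e.θ = e.φ) {z : State V K N.actuated}
    (h : ∑ i, (N.storageMaps C i (z.toVec i) - N.storageMaps C i (e.toVec i)) *
      N.vectorField c C ybar z.toVec i = 0) :
    C.flow z.μ = z.ξ ∧ C.input z.θ = z.φ ∧
      C.comm.laplacian *ᵥ (c.Q *ᵥ z.φ + c.r) = 0 := by
  rw [sum_storageMaps_mul_vectorField he hy hξ hφ] at h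
  have h1 := N.dotProduct_Psi_sub_nonpos z.x e.x
  have h2 : 0 ≤ (C.flow z.μ - z.ξ) ⬝ᵥ (C.flow z.μ - z.ξ) :=
    Finset.sum_nonneg fun _ _ => mul_self_nonneg _
  have h3 : 0 ≤ (C.input z.θ - z.φ) ⬝ᵥ (C.input z.θ - z.φ) :=
    Finset.sum_nonneg fun _ _ => mul_self_nonneg _
  have h4 := hbal.dotProduct_laplacian_mulVec_nonneg (c.Q *ᵥ (z.φ - e.φ))
  refine ⟨sub_eq_zero.1 (dotProduct_self_eq_zero.1 (by linarith)),
    sub_eq_zero.1 (dotProduct_self_eq_zero.1 (by linarith)), ?_⟩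
  have h5 : C.comm.laplacian *ᵥ (c.Q *ᵥ (z.φ - e.φ)) = 0 :=
    CommGraph.laplacian_mulVec_eq_zero
      (hbal.eq_of_dotProduct_laplacian_mulVec_eq_zero hstrong (by linarith))
  obtain ⟨-, -, -, -, h6⟩ := isEquilibrium_iff.1 he
  simp only [rhs, hφ, sub_self, zero_sub, neg_eq_zero] at h6
  have hL := InputCost.Q_mulVec_eq_zero h6
  have h7 : c.Q *ᵥ z.φ + c.r = c.Q *ᵥ (z.φ - e.φ) + (c.Q *ᵥ e.φ + c.r) := by
    rw [Matrix.mulVec_sub]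
    abel
  rw [h7, Matrix.mulVec_add, h5, hL, add_zero]

/-- A trajectory which does not dissipate starts in an equilibrium. -/
theorem vectorField_eq_zero_of_not_dissipating (hconn : N.graph.toSimpleGraph.Connected)
    (hinput : N.actuated.Nonempty) (hset : N.output xbar = ybar)
    (hf : ∀ k, StrictMono (C.f k)) (hg : ∀ i, StrictMono (C.g i))
    {v : ℝ → V ⊕ K ⊕ K ⊕ N.actuated ⊕ N.actuated → ℝ}
    (hv : IsIntegralCurveOn v
      (fun _ w i => N.vectorField c C ybar w i / N.timeConstants C i) (Set.Ici 0))
    (hdiss : ∀ t, 0 ≤ t → C.flow (State.ofVec (v t)).μ = (State.ofVec (v t)).ξ ∧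
      C.input (State.ofVec (v t)).θ = (State.ofVec (v t)).φ ∧
      C.comm.laplacian *ᵥ (c.Q *ᵥ (State.ofVec (v t)).φ + c.r) = 0) :
    N.vectorField c C ybar (v 0) = 0 := by
  set z : ℝ → State V K N.actuated := fun t => State.ofVec (v t) with hz
  have hd : ∀ i t, 0 ≤ t → HasDerivWithinAt (fun t => v t i)
      (N.vectorField c C ybar (v t) i / N.timeConstants C i) (Set.Ici 0) t := fun i t ht =>
    hasDerivWithinAt_pi.1 (hv t ht) i
  have hconst : ∀ i, (∀ t, 0 ≤ t → N.vectorField c C ybar (v t) i = 0) → ∀ t, 0 ≤ t →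
      v t i = v 0 i := fun i hi t ht =>
    eq_of_hasDerivWithinAt_zero (fun s hs => by simpa [hi s hs] using hd i s hs) ht
  have hrest : ∀ i a, (∀ t, 0 ≤ t → v t i = a) → ∀ t, 0 ≤ t →
      N.vectorField c C ybar (v t) i = 0 := fun i a ha t ht =>
    (div_eq_zero_iff.1 (deriv_eq_zero_of_forall_eq ha ht (hd i t ht))).resolve_right
      (N.timeConstants_pos C i).ne'
  have hRξ : ∀ t, 0 ≤ t → ∀ k, N.vectorField c C ybar (v t) (.inr (.inr (.inl k))) = 0 :=
    fun t ht k => sub_eq_zero.2 (congrFun (hdiss t ht).1 k)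
  have hRφ : ∀ t, 0 ≤ t → ∀ i,
      N.vectorField c C ybar (v t) (.inr (.inr (.inr (.inr i)))) = 0 := by
    intro t ht i
    obtain ⟨-, h2, h3⟩ := hdiss t ht
    have : (N.rhs c C ybar (z t)).φ = 0 := by
      simp only [rhs, hz, h2, h3, sub_self, Matrix.mulVec_zero]
    exact congrFun this i
  -- Since `f(μ) = ξ` and `ξ` is constant in time, injectivity of `f` makes `μ` constant, so its
  -- derivative vanishes. The argument for `θ` uses `g` and `φ`.
  have hRμ : ∀ t, 0 ≤ t → ∀ k, N.vectorField c C ybar (v t) (.inr (.inl k)) = 0 := by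
    intro t ht k
    refine hrest _ (v 0 (.inr (.inl k))) (fun s hs => (hf k).injective ?_) t ht
    exact (congrFun (hdiss s hs).1 k).trans
      ((hconst _ (fun r hr => hRξ r hr k) s hs).trans (congrFun (hdiss 0 le_rfl).1 k).symm)
  have hRθ : ∀ t, 0 ≤ t → ∀ i,
      N.vectorField c C ybar (v t) (.inr (.inr (.inr (.inl i)))) = 0 := by
    intro t ht i
    refine hrest _ (v 0 (.inr (.inr (.inr (.inl i))))) (fun s hs => (hg i).injective ?_) t ht
    exact (congrFun (hdiss s hs).2.1 i).trans
      ((hconst _ (fun r hr => hRφ r hr i) s hs).trans (congrFun (hdiss 0 le_rfl).2.1 i).symm)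
  -- With `μ` and `θ` at rest, the output error is annihilated by `Bᵀ` and `Eᵀ`: it takes the same
  -- value at all nodes, and this value is zero at an actuated node.
  have hx : ∀ t, 0 ≤ t → (z t).x = xbar := by
    intro t ht
    obtain ⟨h1, h2, -⟩ := hdiss t ht
    have hμ : (N.rhs c C ybar (z t)).μ = 0 := funext fun k => hRμ t ht k
    have hθ : (N.rhs c C ybar (z t)).θ = 0 := funext fun i => hRθ t ht i
    simp only [rhs, hz, h1, h2, sub_self, sub_zero, neg_eq_zero] at hμ hθ
    obtain ⟨j, hj⟩ := hinput
    refine N.output_injective (funext fun i => ?_)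
    have h3 := OrientedGraph.eq_of_incidence_transpose_mulVec_eq_zero hconn hμ i j
    have h4 := congrFun hθ ⟨j, hj⟩
    rw [E, indicatorMatrix_transpose_mulVec] at h4
    rw [hset]
    exact sub_eq_zero.1 (h3.trans h4)
  ext (i | k | k | i | i)
  -- The `x` equation is balanced because `x` stays at `xbar` for all times.
  · exact hrest _ (xbar i) (fun t ht => congrFun (hx t ht) i) 0 le_rfl
  · exact hRμ 0 le_rfl k
  · exact hRξ 0 le_rfl k
  · exact hRθ 0 le_rfl i
  · exact hRφ 0 le_rfl i

end FlowNetwork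

/-! ### The main theorem -/

theorem theorem2 {V K Kc : Type*} [Fintype V] [DecidableEq V] [Fintype K] [DecidableEq K]
    [Fintype Kc] (N : FlowNetwork V K Kc) (c : InputCost N.actuated)
    (C : Controller K N.actuated) (ybar : V → ℝ)
    (lamLo lamHi : K → EReal) (uLo uHi : N.actuated → EReal)
    -- the graph is connected
    (hconn : N.graph.toSimpleGraph.Connected)
    -- there is at least one controllable input
    (hinput : N.actuated.Nonempty)
    -- feasible setpoint; `xbar` is the unique state with output `ybar`
    (xbar : V → ℝ) (hsetpoint : N.output xbar = ybar)
    -- the communication graph is balanced and strongly connected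
    (hbal : C.comm.Balanced) (hstrong : C.comm.StronglyConnected)
    -- controller outputs
    (hout : C.OutputsWithin lamLo lamHi uLo uHi)
    -- attainability of the steady state
    (hatt : N.Attainable c C xbar) :
    -- the input `û` is the optimal one
    N.IsOptimalInput c xbar (N.uHat c xbar) ∧
    -- there is a steady state
    (∃ e, N.IsEquilibrium c C ybar e) ∧
    -- from every initial state there is a solution for all `t ≥ 0`
    (∀ z₀ : State V K N.actuated, ∃ z, N.IsSolution c C ybar z ∧ z 0 = z₀) ∧
    -- for `Υ₂` taken with respect to any steady state `e`
    ∀ e, N.IsEquilibrium c C ybar e →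
      (∀ a ∈ N.Upsilon2 C e, N.output a.x = ybar ∧ C.input a.θ = N.uHat c xbar) ∧
      ∀ z, N.IsSolution c C ybar z →
        -- every solution converges to a point of `Υ₂`, which is an equilibrium, so that the
        -- flow `λ = f(μ)` is constant there
        (∃ a ∈ N.Upsilon2 C e, N.IsEquilibrium c C ybar a ∧ ConvergesTo z a) ∧
        -- output regulation and optimal input
        Tendsto (fun t => ‖N.output (z t).x - ybar‖) atTop (𝓝 0) ∧
        Tendsto (fun t => ‖C.input (z t).θ - N.uHat c xbar‖) atTop (𝓝 0) ∧
        -- flow and input constraints, for all times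
        ∀ t : ℝ, 0 ≤ t →
          (∀ k, lamLo k < (C.flow (z t).μ k : EReal) ∧ (C.flow (z t).μ k : EReal) < lamHi k) ∧
          (∀ i, uLo i < (C.input (z t).θ i : EReal) ∧ (C.input (z t).θ i : EReal) < uHi i) := by
  have hchar : ∀ e, N.IsEquilibrium c C ybar e → e.x = xbar ∧ C.flow e.μ = e.ξ ∧
      C.input e.θ = N.uHat c xbar ∧ e.φ = N.uHat c xbar ∧
      N.SteadyInput xbar (N.uHat c xbar) (C.flow e.μ) := fun e he =>
    he.eq_and_steadyInput hconn hinput hbal hstrong hsetpoint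
  have hstorage := N.continuous_storageMaps (fun k => (hout.f_contDiff k).continuous)
    (fun i => (hout.g_contDiff i).continuous)
  have hmono := N.strictMono_storageMaps hout.f_strictMono hout.g_strictMono
  have hcd := N.contDiff_vectorField (c := c) (ybar := ybar) hout.f_contDiff hout.g_contDiff
  have hvec : ∀ w, N.vectorField c C ybar w = 0 →
      N.IsEquilibrium c C ybar (State.ofVec w) := fun w hw => by
    rw [← FlowNetwork.vectorField_toVec_eq_zero]
    simpa using hw
  have hdiss : ∀ w, N.vectorField c C ybar w = 0 → ∀ v,
      ∑ i, (N.storageMaps C i (v i) - N.storageMaps C i (w i)) *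
        N.vectorField c C ybar v i ≤ 0 := by
    intro w hw v
    obtain ⟨h1, h2, h3, h4, -⟩ := hchar _ (hvec w hw)
    have := FlowNetwork.sum_storageMaps_mul_vectorField_nonpos hbal (hvec w hw)
      (h1 ▸ hsetpoint) h2 (h3.trans h4.symm) (State.ofVec v)
    simpa only [State.toVec_ofVec] using this
  have hinv : ∀ w, N.vectorField c C ybar w = 0 →
      ∀ v : ℝ → V ⊕ K ⊕ K ⊕ N.actuated ⊕ N.actuated → ℝ,
      IsIntegralCurveOn v (fun _ w i => N.vectorField c C ybar w i / N.timeConstants C i)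
        (Set.Ici 0) →
      (∀ t, 0 ≤ t → ∑ i, (N.storageMaps C i (v t i) - N.storageMaps C i (w i)) *
        N.vectorField c C ybar (v t) i = 0) → N.vectorField c C ybar (v 0) = 0 := by
    intro w hw v hv hv'
    obtain ⟨h1, h2, h3, h4, -⟩ := hchar _ (hvec w hw)
    refine FlowNetwork.vectorField_eq_zero_of_not_dissipating hconn hinput hsetpoint
      hout.f_strictMono hout.g_strictMono hv fun t ht => ?_
    refine FlowNetwork.eq_of_sum_storageMaps_mul_vectorField_eq_zero hbal hstrong (hvec w hw)
      (h1 ▸ hsetpoint) h2 (h3.trans h4.symm) ?_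
    simpa only [State.toVec_ofVec] using hv' t ht
  have hex := FlowNetwork.exists_isEquilibrium hconn hinput hsetpoint hatt
  refine ⟨FlowNetwork.isOptimalInput_uHat hconn hinput xbar, hex, fun z₀ => ?_, fun e he => ?_⟩
  · obtain ⟨e, he⟩ := hex
    obtain ⟨w, hw0, hw⟩ := exists_solution_of_dissipative (N.timeConstants_pos C) hstorage hmono
      hcd (hdiss _ (FlowNetwork.vectorField_toVec_eq_zero.2 he)) z₀.toVec
    refine ⟨fun t => State.ofVec (w t), ?_, by simp [hw0]⟩
    rw [FlowNetwork.isSolution_iff]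
    simpa only [State.toVec_ofVec] using hw
  obtain ⟨hex', heξ, heθ, heφ, hes⟩ := hchar e he
  refine ⟨?_, fun z hz => ?_⟩
  · rintro a ⟨-, -, hax, haθ, -⟩
    rw [hax, haθ, hex']
    exact ⟨hsetpoint, heθ⟩
  obtain ⟨w, hw, hlim⟩ := exists_tendsto_of_dissipative (N.timeConstants_pos C) hstorage hmono
    hcd hdiss hinv ⟨_, FlowNetwork.vectorField_toVec_eq_zero.2 he⟩
    (FlowNetwork.isSolution_iff.1 hz)
  have ha := hvec w hw
  obtain ⟨hax, haξ, haθ, haφ, has⟩ := hchar _ ha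
  have hconv : ConvergesTo z (State.ofVec w) := by
    rw [State.convergesTo_iff]
    simpa only [State.toVec_ofVec] using hlim
  -- Both flows balance the same input in the same state, so they differ by an element of `ker B`.
  -- The condition on `ξ` follows, as `ξ = f(μ)` at equilibria.
  have hB : N.B *ᵥ (C.flow (State.ofVec w).μ - C.flow e.μ) = 0 := by
    have h := has.symm.trans hes
    rw [Matrix.mulVec_sub, sub_eq_zero]
    simpa using h
  refine ⟨⟨State.ofVec w, ⟨hB, by rwa [← haξ, ← heξ], hax.trans hex'.symm, ?_,
    haφ.trans heφ.symm⟩, ha, hconv⟩, ?_, ?_, fun t _ => ⟨fun k => ?_, fun i => ?_⟩⟩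
  · exact funext fun i => (hout.g_strictMono i).injective (congrFun (haθ.trans heθ.symm) i)
  · have hcont : Continuous N.output := continuous_pi fun i =>
      (N.h_contDiff i).continuous.comp (continuous_apply i)
    rw [← tendsto_iff_norm_sub_tendsto_zero, ← hsetpoint, ← hax]
    exact (hcont.tendsto _).comp hconv.1
  · have hcont : Continuous C.input := continuous_pi fun i =>
      (hout.g_contDiff i).continuous.comp (continuous_apply i)
    rw [← tendsto_iff_norm_sub_tendsto_zero, ← haθ]
    exact (hcont.tendsto _).comp hconv.2.2.2.1
  -- The constraints hold along any trajectory because flow and input are values of `f` and `g`.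
  · exact (hout.f_range k).subset ⟨_, rfl⟩
  · exact (hout.g_range i).subset ⟨_, rfl⟩
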